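/- Let $n \geq 2$. Let $\mathcal{T}_n$ be the Tits building of $\mathrm{GL}_n\mathbb{Q}$, i.e. the simplicial complex whose $p$-simplices are the flags $0 \subsetneq V_0 \subsetneq \cdots \subsetneq V_p \subsetneq \mathbb{Q}^n$ of $\mathbb{Q}$-subspaces, and let $\mathrm{St}_n = \widetilde{H}_{n-2}(\mathcal{T}_n;\mathbb{Z})$ be the Steinberg module, with the action of $\mathrm{GL}_n\mathbb{Z} \subset \mathrm{GL}_n\mathbb{Q}$ induced by the action on flags. For an ordered basis $(w_1,\ldots,w_n)$ of $\mathbb{Q}^n$, its apartment class in $\mathrm{St}_n$ is the homology class of the cycle $$\sum_{\sigma\in S_n} (-1)^\sigma \big(\langle w_{\sigma(1)}\rangle \subsetneq \langle w_{\sigma(1)},w_{\sigma(2)}\rangle \subsetneq \cdots \subsetneq \langle w_{\sigma(1)},\ldots,w_{\sigma(n-1)}\rangle\big).$$ Then $\mathrm{St}_n$ is the abelian group with generators $[v_1,\ldots,v_n]$, one for each ordered basis $(v_1,\ldots,v_n)$ of $\mathbb{Z}^n$, subject to the following three families of relations, for all ordered bases $(v_1,\ldots,v_n)$ of $\mathbb{Z}^n$: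 1. $[v_1,v_2,v_3,\ldots,v_n]=[v_1,v_1+v_2,v_3,\ldots,v_n]+[v_1+v_2,v_2,v_3,\ldots,v_n]$; 2. $[\pm v_1,\pm v_2,\ldots,\pm v_n]=[v_1,v_2,\ldots,v_n]$ for any choices of signs; 3. $[v_{\sigma(1)},v_{\sigma(2)},\ldots,v_{\sigma(n)}]=(-1)^\sigma\,[v_1,v_2,\ldots,v_n]$ for any $\sigma\in S_n$. More precisely, there is an isomorphism from the abelian group with this presentation onto $\mathrm{St}_n$ that sends each generator $[v_1,\ldots,v_n]$ to the apartment class of $(v_1,\ldots,v_n)$. Under it, the action of $\mathrm{GL}_n\mathbb{Z}$ on $\mathrm{St}_n$ is given by $M\cdot[v_1,\ldots,v_n]=[M v_1,\ldots,M v_n]$. -/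

import Mathlib

open scoped Matrix

noncomputable section

namespace TitsSteinberg

/-! ### Reduced simplicial homology of the order complex of a poset -/

/-- Strict chains `a₀ < a₁ < ⋯ < a_{k-1}` of `k` elements: the simplices with `k` vertices
of the order complex `|A|`. For `k = 0` this is the single empty simplex. -/
def Flag (A : Type*) [Preorder A] (k : ℕ) : Type _ :=
  {s : Fin k → A // StrictMono s}

/-- The face of a simplex obtained by deleting its `i`-th vertex. -/
def Flag.face {A : Type*} [Preorder A] {k : ℕ} (s : Flag A (k + 1)) (i : Fin (k + 1)) :
    Flag A k :=
  ⟨s.1 ∘ i.succAbove, s.2.comp (Fin.strictMono_succAbove i)⟩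

/-- Integral simplicial chains on simplices with `k` vertices, i.e. of dimension `k - 1`.
Since the empty simplex is included, these are the augmented chains. -/
abbrev Chains (A : Type*) [Preorder A] (k : ℕ) : Type _ := Flag A k →₀ ℤ

/-- The simplicial boundary `s ↦ ∑ i, (-1)^i (i-th face of s)`; for `k = 0` it is the
augmentation. -/
def boundary (A : Type*) [Preorder A] (k : ℕ) : Chains A (k + 1) →ₗ[ℤ] Chains A k :=
  Finsupp.linearCombination ℤ
    (fun s => ∑ i : Fin (k + 1), (-1 : ℤ) ^ (i : ℕ) • Finsupp.single (s.face i) (1 : ℤ))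

theorem boundary_single (A : Type*) [Preorder A] (k : ℕ) (s : Flag A (k + 1)) :
    boundary A k (Finsupp.single s 1) =
      ∑ i : Fin (k + 1), (-1 : ℤ) ^ (i : ℕ) • Finsupp.single (s.face i) (1 : ℤ) := by
  simp [boundary]

theorem boundary_boundary (A : Type*) [Preorder A] (k : ℕ) (c : Chains A (k + 1 + 1)) :
    boundary A k (boundary A (k + 1) c) = 0 := by
  have h : (boundary A k).comp (boundary A (k + 1)) = 0 := by
    apply Finsupp.lhom_ext'
    intro s
    apply LinearMap.ext_ring
    simp only [LinearMap.comp_apply, Finsupp.lsingle_apply, boundary_single, map_sum, map_smul,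
      LinearMap.zero_apply, Finset.smul_sum, smul_smul]
    rw [← Finset.sum_product']
    refine Finset.sum_involution
      (fun p _ => (p.1.succAbove p.2, p.2.predAbove p.1)) ?_ ?_ ?_ ?_
    · rintro ⟨i, j⟩ _
      have hf : (s.face (i.succAbove j)).face (j.predAbove i) = (s.face i).face j := by
        apply Subtype.ext
        funext l
        exact congrArg s.1 (Fin.succAbove_succAbove_succAbove_predAbove i j l)
      simp only [hf]
      rw [← add_smul, ← pow_add, ← pow_add, Fin.neg_one_pow_succAbove_add_predAbove]
      simp
    · rintro ⟨i, j⟩ _ _ h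
      exact Fin.succAbove_ne i j (congrArg Prod.fst h)
    · intro p _
      exact Finset.mem_univ _
    · rintro ⟨i, j⟩ _
      exact Prod.ext (Fin.succAbove_succAbove_predAbove i j)
        (Fin.predAbove_predAbove_succAbove i j)
  exact LinearMap.congr_fun h c

/-- Reduced homology `H̃_d(|A|; ℤ)`: cycles modulo boundaries in the augmented simplicial chain
complex, at the chains on `d`-dimensional simplices. -/
abbrev ReducedHomology (A : Type*) [Preorder A] (d : ℕ) : Type _ :=
  LinearMap.ker (boundary A d) ⧸
    (LinearMap.range (boundary A (d + 1))).submoduleOf (LinearMap.ker (boundary A d))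

/-! ### Functoriality for strictly monotone maps -/

section Map

variable {A B C : Type*} [Preorder A] [Preorder B] [Preorder C]

/-- The image of a simplex under a strictly monotone map. -/
def Flag.map (f : A → B) (hf : StrictMono f) {k : ℕ} (s : Flag A k) : Flag B k :=
  ⟨f ∘ s.1, hf.comp s.2⟩

/-- The induced map on chains. -/
def chainsMap (f : A → B) (hf : StrictMono f) (k : ℕ) : Chains A k →ₗ[ℤ] Chains B k :=
  Finsupp.lmapDomain ℤ ℤ (Flag.map f hf)

theorem boundary_chainsMap (f : A → B) (hf : StrictMono f) (k : ℕ) (c : Chains A (k + 1)) :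
    boundary B k (chainsMap f hf (k + 1) c) = chainsMap f hf k (boundary A k c) := by
  have h : (boundary B k).comp (chainsMap f hf (k + 1)) =
      (chainsMap f hf k).comp (boundary A k) := by
    apply Finsupp.lhom_ext'
    intro s
    apply LinearMap.ext_ring
    simp only [LinearMap.comp_apply, Finsupp.lsingle_apply, boundary_single, map_sum, map_smul]
    simp only [chainsMap, Finsupp.lmapDomain_apply, Finsupp.mapDomain_single, boundary_single]
    rfl
  exact LinearMap.congr_fun h c

/-- The induced map on cycles. -/
def cyclesMap (f : A → B) (hf : StrictMono f) (d : ℕ) :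
    LinearMap.ker (boundary A d) →ₗ[ℤ] LinearMap.ker (boundary B d) :=
  (chainsMap f hf (d + 1)).restrict (fun c hc => by
    rw [LinearMap.mem_ker] at hc ⊢
    rw [boundary_chainsMap, hc, map_zero])

/-- The induced map on reduced homology. -/
def homologyMap (f : A → B) (hf : StrictMono f) (d : ℕ) :
    ReducedHomology A d →ₗ[ℤ] ReducedHomology B d :=
  Submodule.mapQ _ _ (cyclesMap f hf d) (by
    rintro c ⟨e, he⟩
    exact ⟨chainsMap f hf (d + 1 + 1) e, by rw [boundary_chainsMap, he]; rfl⟩)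

theorem homologyMap_id (hf : StrictMono (id : A → A)) (d : ℕ) :
    homologyMap (id : A → A) hf d = LinearMap.id := by
  apply LinearMap.ext
  intro x
  obtain ⟨c, rfl⟩ := Submodule.Quotient.mk_surjective _ x
  have h : cyclesMap (id : A → A) hf d c = c := by
    apply Subtype.ext
    change Finsupp.mapDomain (Flag.map id hf) c.1 = c.1
    exact Finsupp.mapDomain_id
  change Submodule.Quotient.mk (cyclesMap (id : A → A) hf d c) = _
  rw [h]
  rfl

theorem homologyMap_comp (f : A → B) (hf : StrictMono f) (g : B → C) (hg : StrictMono g) (d : ℕ) :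
    homologyMap (g ∘ f) (hg.comp hf) d = (homologyMap g hg d).comp (homologyMap f hf d) := by
  apply LinearMap.ext
  intro x
  obtain ⟨c, rfl⟩ := Submodule.Quotient.mk_surjective _ x
  have h : cyclesMap (g ∘ f) (hg.comp hf) d c = cyclesMap g hg d (cyclesMap f hf d c) := by
    apply Subtype.ext
    change Finsupp.mapDomain (Flag.map (g ∘ f) (hg.comp hf)) c.1 =
      Finsupp.mapDomain (Flag.map g hg) (Finsupp.mapDomain (Flag.map f hf) c.1)
    rw [← Finsupp.mapDomain_comp]
    rfl
  change Submodule.Quotient.mk (cyclesMap (g ∘ f) (hg.comp hf) d c) =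
    Submodule.Quotient.mk (cyclesMap g hg d (cyclesMap f hf d c))
  rw [h]

end Map

/-! ### The Tits building and the Steinberg module -/

/-- The poset of proper nonzero subspaces of `ℚⁿ`. Its order complex is the Tits building of
`GL_n ℚ`: the `p`-simplices are the flags `0 ⊊ V₀ ⊊ ⋯ ⊊ V_p ⊊ ℚⁿ`. -/
abbrev Tits (n : ℕ) : Type :=
  {V : Submodule ℚ (Fin n → ℚ) // V ≠ ⊥ ∧ V ≠ ⊤}

/-- The Steinberg module `St_n = H̃_{n-2}(Tits building; ℤ)`, for `n ≥ 2`. -/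
abbrev Steinberg (n : ℕ) : Type := ReducedHomology (Tits n) (n - 2)

/-- An invertible matrix as a linear automorphism `x ↦ g x` of column vectors. -/
def glEquiv {n : ℕ} {R : Type*} [CommRing R] (g : GL (Fin n) R) :
    (Fin n → R) ≃ₗ[R] (Fin n → R) :=
  LinearEquiv.ofLinearMap (Matrix.mulVecLin g.1) (Matrix.mulVecLin g⁻¹.1)
    (by rw [← Matrix.mulVecLin_mul, ← Units.val_mul, mul_inv_cancel]; exact Matrix.mulVecLin_one)
    (by rw [← Matrix.mulVecLin_mul, ← Units.val_mul, inv_mul_cancel]; exact Matrix.mulVecLin_one)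

theorem glEquiv_apply {n : ℕ} {R : Type*} [CommRing R] (g : GL (Fin n) R) (x : Fin n → R) :
    glEquiv g x = g.1 *ᵥ x := rfl

/-- `GL_n ℚ` acts on subspaces by `V ↦ g V`. -/
def titsMap {n : ℕ} (g : GL (Fin n) ℚ) (V : Tits n) : Tits n :=
  ⟨V.1.map (glEquiv g).toLinearMap, by
    have h := V.2
    constructor
    · intro h0
      refine h.1 (Submodule.map_injective_of_injective (f := (glEquiv g).toLinearMap)
        (glEquiv g).injective ?_)
      rw [h0, Submodule.map_bot]
    · intro h1
      refine h.2 (Submodule.map_injective_of_injective (f := (glEquiv g).toLinearMap)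
        (glEquiv g).injective ?_)
      rw [h1, Submodule.map_top, LinearEquiv.range]⟩

theorem titsMap_strictMono {n : ℕ} (g : GL (Fin n) ℚ) : StrictMono (titsMap (n := n) g) := by
  intro V W h
  exact Submodule.map_strictMono_of_injective (f := (glEquiv g).toLinearMap)
    (glEquiv g).injective h

theorem titsMap_one {n : ℕ} : titsMap (n := n) 1 = id := by
  have h : (glEquiv (1 : GL (Fin n) ℚ)).toLinearMap = LinearMap.id := Matrix.mulVecLin_one
  funext V
  apply Subtype.ext
  change V.1.map (glEquiv (1 : GL (Fin n) ℚ)).toLinearMap = V.1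
  rw [h, Submodule.map_id]

theorem titsMap_mul {n : ℕ} (g h : GL (Fin n) ℚ) :
    titsMap (g * h) = titsMap (n := n) g ∘ titsMap h := by
  have e : (glEquiv (g * h)).toLinearMap =
      (glEquiv g).toLinearMap.comp (glEquiv h).toLinearMap := Matrix.mulVecLin_mul g.1 h.1
  funext V
  apply Subtype.ext
  change V.1.map (glEquiv (g * h)).toLinearMap =
    (V.1.map (glEquiv h).toLinearMap).map (glEquiv g).toLinearMap
  rw [e, Submodule.map_comp]

/-- The action of `GL_n ℚ` on the Steinberg module, induced by its action on the building. -/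
def steinbergRep (n : ℕ) : Representation ℤ (GL (Fin n) ℚ) (Steinberg n) where
  toFun g := homologyMap (titsMap g) (titsMap_strictMono g) (n - 2)
  map_one' := by
    have : ∀ (f : Tits n → Tits n) (hf : StrictMono f), f = id →
        homologyMap f hf (n - 2) = LinearMap.id := by
      rintro f hf rfl
      exact homologyMap_id hf _
    exact this _ _ titsMap_one
  map_mul' g h := by
    have : ∀ (f : Tits n → Tits n) (hf : StrictMono f), f = titsMap g ∘ titsMap h →
        homologyMap f hf (n - 2) = (homologyMap (titsMap g) (titsMap_strictMono g) (n - 2)).comp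
          (homologyMap (titsMap h) (titsMap_strictMono h) (n - 2)) := by
      rintro f hf rfl
      exact homologyMap_comp _ _ _ _ _
    exact this _ _ (titsMap_mul g h)

/-- The action of `GL_n ℤ ⊆ GL_n ℚ` on the Steinberg module. -/
def steinbergRepInt (n : ℕ) : Representation ℤ (GL (Fin n) ℤ) (Steinberg n) :=
  (steinbergRep n).comp (Matrix.GeneralLinearGroup.map (Int.castRingHom ℚ))

/-! ### Apartment classes -/

/-- Ordered bases of `ℚⁿ`. -/
abbrev RatBasis (n : ℕ) : Type := Module.Basis (Fin n) ℚ (Fin n → ℚ)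

theorem span_image_ne {n : ℕ} (w : RatBasis n) {S : Set (Fin n)} {j : Fin n} (hj : j ∉ S) :
    w j ∉ Submodule.span ℚ (w '' S) :=
  w.linearIndependent.notMem_span_image hj

/-- For a basis `w` of `ℚⁿ`, the full flag
`⟨w₁⟩ ⊊ ⟨w₁, w₂⟩ ⊊ ⋯ ⊊ ⟨w₁, …, w_{n-1}⟩`. -/
def basisFlag {n : ℕ} (hn : 2 ≤ n) (w : RatBasis n) : Flag (Tits n) (n - 2 + 1) :=
  ⟨fun i => ⟨Submodule.span ℚ (w '' {j | (j : ℕ) ≤ (i : ℕ)}), by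
      constructor
      · intro h
        have hm : w ⟨0, by omega⟩ ∈ Submodule.span ℚ (w '' {j | (j : ℕ) ≤ (i : ℕ)}) :=
          Submodule.subset_span ⟨_, Nat.zero_le _, rfl⟩
        rw [h, Submodule.mem_bot] at hm
        exact w.ne_zero _ hm
      · intro h
        have hlt := i.2
        refine span_image_ne w (S := {j | (j : ℕ) ≤ (i : ℕ)}) (j := ⟨n - 1, by omega⟩) ?_ ?_
        · simp only [Set.mem_ofPred_eq]
          omega
        · rw [h]
          trivial⟩,
    by
      intro i i' hii
      have hii' : (i : ℕ) < i' := hii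
      have hlt := i'.2
      refine lt_of_le_of_ne (Submodule.span_mono (Set.image_mono ?_)) ?_
      · intro j hj
        exact le_trans hj hii'.le
      · intro h
        have h' := congrArg Subtype.val h
        simp only at h'
        refine span_image_ne w (S := {j | (j : ℕ) ≤ (i : ℕ)}) (j := ⟨i', by omega⟩) ?_ ?_
        · simp only [Set.mem_ofPred_eq]
          omega
        · rw [h']
          exact Submodule.subset_span ⟨_, le_refl (i' : ℕ), rfl⟩⟩

/-- The fundamental cycle of the apartment of `w`: the signed sum, over all permutations `σ`, of
the simplices `⟨w_{σ(1)}⟩ ⊊ ⟨w_{σ(1)}, w_{σ(2)}⟩ ⊊ ⋯ ⊊ ⟨w_{σ(1)}, …, w_{σ(n-1)}⟩`. -/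
def apartmentChain {n : ℕ} (hn : 2 ≤ n) (w : RatBasis n) : Chains (Tits n) (n - 2 + 1) :=
  ∑ σ : Equiv.Perm (Fin n),
    (Equiv.Perm.sign σ : ℤ) • Finsupp.single (basisFlag hn (w.reindex σ.symm)) (1 : ℤ)

theorem basisFlag_face_swap {n : ℕ} (hn : 2 ≤ n) (w : RatBasis n) (i : Fin (n - 2 + 1))
    (p q : Fin n) (hp : (p : ℕ) = i) (hq : (q : ℕ) = i + 1) :
    (basisFlag hn (w.reindex (Equiv.swap p q))).face i = (basisFlag hn w).face i := by
  apply Subtype.ext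
  funext k
  apply Subtype.ext
  have hk : ((i.succAbove k : Fin (n - 2 + 1)) : ℕ) ≠ i := by
    intro h
    exact Fin.succAbove_ne i k (Fin.ext h)
  change Submodule.span ℚ (w.reindex (Equiv.swap p q) '' {j | (j : ℕ) ≤ (i.succAbove k : ℕ)}) =
    Submodule.span ℚ (w '' {j | (j : ℕ) ≤ (i.succAbove k : ℕ)})
  congr 1
  generalize ((i.succAbove k : Fin (n - 2 + 1)) : ℕ) = m at hk
  have key : ∀ j : Fin n, (j : ℕ) ≤ m → ((Equiv.swap p q j : Fin n) : ℕ) ≤ m := by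
    intro j hj
    rw [Equiv.swap_apply_def]
    split_ifs with h1 h2
    · subst h1; omega
    · subst h2; omega
    · exact hj
  ext x
  constructor
  · rintro ⟨j, hj, rfl⟩
    exact ⟨Equiv.swap p q j, key j hj, by simp⟩
  · rintro ⟨j, hj, rfl⟩
    exact ⟨Equiv.swap p q j, key j hj, by simp⟩

theorem boundary_apartmentChain {n : ℕ} (hn : 2 ≤ n) (w : RatBasis n) :
    boundary (Tits n) (n - 2) (apartmentChain hn w) = 0 := by
  simp only [apartmentChain, map_sum, map_smul, boundary_single, Finset.smul_sum]
  rw [Finset.sum_comm]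
  refine Finset.sum_eq_zero (fun i _ => ?_)
  have hi := i.2
  let p : Fin n := ⟨i, by omega⟩
  let q : Fin n := ⟨i + 1, by omega⟩
  have hpq : p ≠ q := by
    intro h
    have := congrArg Fin.val h
    simp only [p, q] at this
    omega
  refine Finset.sum_involution (fun σ _ => σ * Equiv.swap p q) ?_ ?_ ?_ ?_
  · intro σ _
    have h : w.reindex (σ * Equiv.swap p q).symm = (w.reindex σ.symm).reindex (Equiv.swap p q) := by
      apply Module.Basis.eq_of_apply_eq
      intro j
      simp
    rw [h, basisFlag_face_swap hn _ i p q rfl rfl, Equiv.Perm.sign_mul, Equiv.Perm.sign_swap hpq]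
    simp
  · intro σ _ _ h
    have := mul_eq_left.mp h
    exact hpq (Equiv.swap_eq_one_iff.mp this)
  · intro σ _
    exact Finset.mem_univ _
  · intro σ _
    simp [mul_assoc]

/-- The apartment class `[w₁, …, w_n] ∈ St_n` of an ordered basis of `ℚⁿ`. -/
def apartmentClass {n : ℕ} (hn : 2 ≤ n) (w : RatBasis n) : Steinberg n :=
  Submodule.Quotient.mk ⟨apartmentChain hn w, boundary_apartmentChain hn w⟩

/-! ### Integral bases and the presentation -/

/-- Ordered bases of `ℤⁿ`. -/
abbrev IntBasis (n : ℕ) : Type := Module.Basis (Fin n) ℤ (Fin n → ℤ)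

/-- A basis of `ℤⁿ`, regarded as a basis of `ℚⁿ`. -/
def IntBasis.toRat {n : ℕ} (v : IntBasis n) : RatBasis n :=
  have h : LinearIndependent ℚ (fun i : Fin n => fun k : Fin n => ((v i k : ℤ) : ℚ)) ∧
      Submodule.span ℚ (Set.range fun i : Fin n => fun k : Fin n => ((v i k : ℤ) : ℚ)) = ⊤ := by
    have h1 := (Pi.basisFun ℤ (Fin n)).isUnit_det v
    rw [Module.Basis.is_basis_iff_det (Pi.basisFun ℚ (Fin n))]
    rw [Pi.basisFun_det] at h1 ⊢
    have h2 := h1.map (Int.castRingHom ℚ)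
    change IsUnit ((Int.castRingHom ℚ) (Matrix.det (Matrix.of ⇑v))) at h2
    rw [RingHom.map_det] at h2
    exact h2
  Module.Basis.mk h.1 h.2.ge

theorem IntBasis.toRat_apply {n : ℕ} (v : IntBasis n) (i k : Fin n) :
    v.toRat i k = ((v i k : ℤ) : ℚ) := by
  simp [IntBasis.toRat]

/-- The basis obtained from `v` by replacing `v_j` with `v_i + v_j`, where `i ≠ j`. -/
def IntBasis.replaceAdd {n : ℕ} (v : IntBasis n) (i j : Fin n) (hij : i ≠ j) : IntBasis n :=
  have h : LinearIndependent ℤ (Function.update v j (v i + v j)) ∧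
      Submodule.span ℤ (Set.range (Function.update v j (v i + v j))) = ⊤ := by
    rw [Module.Basis.is_basis_iff_det v, AlternatingMap.map_update_add, AlternatingMap.map_update_self _ _ hij.symm]
    simp [Module.Basis.det_self]
  Module.Basis.mk h.1 h.2.ge

theorem IntBasis.coe_replaceAdd {n : ℕ} (v : IntBasis n) (i j : Fin n) (hij : i ≠ j) :
    ⇑(v.replaceAdd i j hij) = Function.update v j (v i + v j) := by
  simp [IntBasis.replaceAdd]

/-- The generator `[v₁, …, v_n]` of the free abelian group on the ordered bases of `ℤⁿ`. -/
abbrev gen {n : ℕ} (v : IntBasis n) : FreeAbelianGroup (IntBasis n) := FreeAbelianGroup.of v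

/-- The three families of relators. Here `v.unitsSMul ε` is `i ↦ ε_i v_i` and
`v.reindex σ.symm` is `i ↦ v_{σ(i)}`. -/
inductive IsRelator {n : ℕ} (hn : 2 ≤ n) : FreeAbelianGroup (IntBasis n) → Prop
  /-- `[v₁, v₂, v₃, …] = [v₁, v₁ + v₂, v₃, …] + [v₁ + v₂, v₂, v₃, …]` -/
  | manin (v : IntBasis n) :
      IsRelator hn (gen v -
        (gen (v.replaceAdd ⟨0, by omega⟩ ⟨1, by omega⟩ (by simp)) +
          gen (v.replaceAdd ⟨1, by omega⟩ ⟨0, by omega⟩ (by simp))))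
  /-- `[± v₁, …, ± v_n] = [v₁, …, v_n]` -/
  | sign (v : IntBasis n) (ε : Fin n → ℤˣ) :
      IsRelator hn (gen (v.unitsSMul ε) - gen v)
  /-- `[v_{σ(1)}, …, v_{σ(n)}] = (-1)^σ [v₁, …, v_n]` -/
  | perm (v : IntBasis n) (σ : Equiv.Perm (Fin n)) :
      IsRelator hn (gen (v.reindex σ.symm) - (Equiv.Perm.sign σ : ℤ) • gen v)

/-- The abelian group with one generator for each ordered basis of `ℤⁿ`, subject to the relators
above. -/
abbrev Presented {n : ℕ} (hn : 2 ≤ n) : Type :=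
  FreeAbelianGroup (IntBasis n) ⧸ AddSubgroup.closure {r | IsRelator hn r}

/-- The class of the generator `[v₁, …, v_n]` in the presented group. -/
def symbol {n : ℕ} (hn : 2 ≤ n) (v : IntBasis n) : Presented hn :=
  QuotientAddGroup.mk (gen v)

/-- `M · (v₁, …, v_n) = (M v₁, …, M v_n)` for `M ∈ GL_n ℤ`. -/
def IntBasis.act {n : ℕ} (M : GL (Fin n) ℤ) (v : IntBasis n) : IntBasis n :=
  v.map (glEquiv M)

theorem IntBasis.act_apply {n : ℕ} (M : GL (Fin n) ℤ) (v : IntBasis n) (i : Fin n) :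
    v.act M i = M.1 *ᵥ v i := by
  simp [IntBasis.act, glEquiv_apply]

end TitsSteinberg

end

noncomputable section

namespace TitsSteinberg

/-! ### Permutations and omitted entries -/

/-! The proof is an induction on dimension that treats all rational subspaces U of ℚⁿ at once. `Symb
M k` is given by the relations of the theorem on bases of the lattices U ∩ M with dim U = k. The
relations never change the span, so it is the direct sum over U of the groups attached to U. Its
generators are all k-tuples, with the non-primitive ones killed, so that no generator carries a
proof.

Omitting one entry of a tuple, with sign, defines a residue from the group of U to the groups of the
hyperplanes H of U. On chains of full flags of U, with U itself included as top member, the residue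
omits the top. `apartmentMap` is built recursively so as to commute with these residues. The claim
is that it identifies symbols with flag cycles.

Fix a nonzero e in U ∩ M and keep only the residues at those H that do not contain e. For flag
cycles this partial residue is injective: `IsFlagCycle.eq_zero`. For symbols it is bijective onto
the sum of the groups of these H. Surjectivity, `exists_residueAt_eq`, is Euclidean descent:
complete a basis b of H by v with e = d v + ∑ a_i b_i and 0 ≤ a_i < d; the faces of (v, b) other
than b contain e or have index a_i < d. Injectivity, `eq_zero_of_residueAt_eq_zero`, uses left
inverses built by induction on a bound for the coordinates of e: at bound d, a basis of a hyperplane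
of index d is sent to its normalized completion, corrected by the previous left inverse. The work
lies in `isSymb_completionValue`, which shows that this respects the relations. Induction on k then
gives `apartmentMap_injective` and `IsFlagCycle.exists_apartmentMap_eq`.

To conclude, primitive n-tuples for ℤⁿ are exactly the integral bases, so `Symb` in degree n is the
presented group. On the building side, homology in top degree consists of cycles, and faces of a
maximal flag that omit different dimensions cannot cancel, so cycles of the building are flag cycles
with top ℚⁿ. Equivariance is checked on apartment classes. -/

/-- A permutation induces a permutation of the complements of `i` and of its image. -/
theorem exists_perm_succAbove {k : ℕ} (σ : Equiv.Perm (Fin (k + 1))) (i : Fin (k + 1)) :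
    ∃ τ : Equiv.Perm (Fin k),
      (∀ j, σ (i.succAbove j) = (σ i).succAbove (τ j)) ∧
      (-1 : ℤ) ^ (i : ℕ) * (Equiv.Perm.sign τ : ℤ) =
        (Equiv.Perm.sign σ : ℤ) * (-1) ^ (σ i : ℕ) := by
  -- The two cycles bring the omitted positions `i` and `σ i` to 0 and preserve the order of the
  -- others. Hence ρ fixes 0 and acts as τ on successors, and the signs of the cycles give the
  -- formula.
  set ρ : Equiv.Perm (Fin (k + 1)) := (σ i).cycleRange * σ * (i.cycleRange)⁻¹ with hρ
  obtain ⟨⟨p, τ⟩, hτ⟩ := Equiv.Perm.decomposeFin.symm.surjective ρ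
  have h0 : p = 0 := by
    have := congrArg (fun f : Equiv.Perm (Fin (k + 1)) => f 0) hτ
    simp only [Equiv.Perm.decomposeFin_symm_apply_zero] at this
    rw [this, hρ]
    simp [Equiv.Perm.mul_apply, Equiv.Perm.inv_def]
  subst h0
  refine ⟨τ, fun j => ?_, ?_⟩
  · have h1 : ρ j.succ = (τ j).succ := by
      rw [← hτ]; simp
    have h2 : (σ i).cycleRange (σ (i.succAbove j)) = (τ j).succ := by
      rw [← h1, hρ]
      simp [Equiv.Perm.mul_apply, Equiv.Perm.inv_def]
    rw [← Fin.cycleRange_symm_succ (σ i), ← h2, Equiv.symm_apply_apply]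
  · have h := congrArg Equiv.Perm.sign hτ
    rw [Equiv.Perm.decomposeFin.symm_sign, hρ] at h
    simp only [if_true, one_mul, Equiv.Perm.sign_mul, Equiv.Perm.sign_inv,
      Fin.sign_cycleRange] at h
    rw [h]
    push_cast
    have e : ((-1 : ℤ) ^ (i : ℕ)) * (-1) ^ (i : ℕ) = 1 := by
      rw [← mul_pow]; simp
    linear_combination ((Equiv.Perm.sign σ : ℤ) * (-1) ^ (σ i : ℕ)) * e

/-- Permuting a tuple and omitting an entry permutes the remaining entries, with a sign. -/
theorem exists_removeNth_comp_perm {α : Type*} {k : ℕ} (σ : Equiv.Perm (Fin (k + 1)))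
    (i : Fin (k + 1)) :
    ∃ τ : Equiv.Perm (Fin k),
      (∀ w : Fin (k + 1) → α, i.removeNth (w ∘ σ) = (σ i).removeNth w ∘ τ) ∧
      (-1 : ℤ) ^ (i : ℕ) * (Equiv.Perm.sign τ : ℤ) =
        (Equiv.Perm.sign σ : ℤ) * (-1) ^ (σ i : ℕ) := by
  obtain ⟨τ, h1, h2⟩ := exists_perm_succAbove σ i
  exact ⟨τ, fun w => funext fun j => congrArg w (h1 j), h2⟩

/-! ### Linear combinations of modified tuples -/

section Sums

variable {R V : Type*} [Ring R] [AddCommGroup V] [Module R V]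

/-- A move on vectors becomes the transposed move on coefficients. Rational coefficients serve to
test primitivity, integral ones to follow the coordinates of `e`. -/
theorem sum_update_add {k : ℕ} (c : Fin k → R) (b : Fin k → V)
    {i j : Fin k} (hij : i ≠ j) :
    ∑ l, c l • Function.update b j (b i + b j) l =
      ∑ l, Function.update c i (c i + c j) l • b l := by
  have h : ∀ l, c l • Function.update b j (b i + b j) l -
      Function.update c i (c i + c j) l • b l =
        (if l = j then c j • b i else 0) - (if l = i then c j • b i else 0) := by
    intro l
    rcases eq_or_ne l j with rfl | hj
    · simp [hij.symm]
    · rcases eq_or_ne l i with rfl | hi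
      · simp [hj, add_smul]
      · simp [hj, hi]
  rw [← sub_eq_zero, ← Finset.sum_sub_distrib, Finset.sum_congr rfl (fun l _ => h l)]
  simp

theorem sum_update_neg {k : ℕ} (c : Fin k → R) (b : Fin k → V)
    (i : Fin k) :
    ∑ l, c l • Function.update b i (-b i) l = ∑ l, Function.update c i (-c i) l • b l := by
  refine Finset.sum_congr rfl (fun l _ => ?_)
  rcases eq_or_ne l i with rfl | h
  · simp
  · simp [h]

theorem sum_comp_perm {k : ℕ} (c : Fin k → R) (b : Fin k → V)
    (σ : Equiv.Perm (Fin k)) :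
    ∑ l, c l • (b ∘ σ) l = ∑ l, (c ∘ σ.symm) l • b l := by
  rw [← Equiv.sum_comp σ (fun l => (c ∘ σ.symm) l • b l)]
  simp

theorem sum_removeNth {k : ℕ} (i : Fin (k + 1)) (c : Fin k → R)
    (w : Fin (k + 1) → V) :
    ∑ l, c l • i.removeNth w l = ∑ l, (i.insertNth 0 c : Fin (k + 1) → R) l • w l := by
  rw [Fin.sum_univ_succAbove _ i]
  simp [Fin.removeNth]

end Sums

/-! ### Primitive tuples -/

section Primitive

variable {W : Type*} [AddCommGroup W] [Module ℚ W]

/-- The rational span of a tuple. -/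
abbrev sp {k : ℕ} (b : Fin k → W) : Submodule ℚ W := Submodule.span ℚ (Set.range b)

/-- A tuple is primitive for the lattice `M` if it is linearly independent and
its rational span meets `M` in its integral span. -/
structure IsPrimitive (M : AddSubgroup W) {k : ℕ} (b : Fin k → W) : Prop where
  linearIndependent : LinearIndependent ℚ b
  mem_iff : ∀ c : Fin k → ℚ, ∑ i, c i • b i ∈ M ↔ ∀ i, ∃ z : ℤ, c i = z

theorem mem_sp_iff {k : ℕ} {b : Fin k → W} {x : W} :
    x ∈ sp b ↔ ∃ c : Fin k → ℚ, ∑ i, c i • b i = x :=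
  Submodule.mem_span_range_iff_exists_fun ℚ

theorem sp_update_add {k : ℕ} (b : Fin k → W) {i j : Fin k} (hij : i ≠ j) :
    sp (Function.update b j (b i + b j)) = sp b := by
  have := Submodule.span_range_update_add_smul (R := ℚ) hij b 1
  rw [one_smul, add_comm] at this
  exact this

theorem sp_update_neg {k : ℕ} (b : Fin k → W) (i : Fin k) :
    sp (Function.update b i (-b i)) = sp b := by
  apply le_antisymm <;> rw [Submodule.span_le]
  · rintro _ ⟨l, rfl⟩
    rcases eq_or_ne l i with rfl | h
    · rw [Function.update_self]
      exact neg_mem (Submodule.subset_span ⟨l, rfl⟩)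
    · rw [Function.update_of_ne h]
      exact Submodule.subset_span ⟨l, rfl⟩
  · rintro _ ⟨l, rfl⟩
    rcases eq_or_ne l i with rfl | h
    · have : -(Function.update b l (-b l)) l ∈ sp (Function.update b l (-b l)) :=
        neg_mem (Submodule.subset_span ⟨l, rfl⟩)
      simpa using this
    · have : (Function.update b i (-b i)) l ∈ sp (Function.update b i (-b i)) :=
        Submodule.subset_span ⟨l, rfl⟩
      simpa [Function.update_of_ne h] using this

theorem sp_comp_perm {k : ℕ} (b : Fin k → W) (σ : Equiv.Perm (Fin k)) : sp (b ∘ σ) = sp b := by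
  rw [sp, sp, σ.surjective.range_comp]

/-! ### Moves that preserve primitivity -/

variable {M : AddSubgroup W}

/-- Common pattern for the moves: `T` is the induced change of coordinates. Its trivial kernel gives
independence, and its respecting integrality in both directions gives the lattice condition. -/
theorem IsPrimitive.of_coordinates {k : ℕ} {b b' : Fin k → W} (hb : IsPrimitive M b)
    (T : (Fin k → ℚ) → Fin k → ℚ) (hT : ∀ c, ∑ l, c l • b' l = ∑ l, T c l • b l)
    (h0 : ∀ c, (∀ i, T c i = 0) → ∀ i, c i = 0)
    (hz : ∀ c, (∀ i, ∃ z : ℤ, T c i = z) ↔ ∀ i, ∃ z : ℤ, c i = z) : IsPrimitive M b' where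
  linearIndependent := by
    rw [Fintype.linearIndependent_iff]
    intro c hc
    rw [hT] at hc
    exact h0 c (Fintype.linearIndependent_iff.mp hb.linearIndependent _ hc)
  mem_iff c := by rw [hT, hb.mem_iff, hz]

theorem IsPrimitive.update_add {k : ℕ} {b : Fin k → W} (hb : IsPrimitive M b) {i j : Fin k}
    (hij : i ≠ j) : IsPrimitive M (Function.update b j (b i + b j)) := by
  refine hb.of_coordinates _ (fun c => sum_update_add c b hij) ?_ ?_
  · intro c h l
    have hj := h j
    rw [Function.update_of_ne hij.symm] at hj
    rcases eq_or_ne l i with rfl | hi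
    · have := h l
      rw [Function.update_self, hj, add_zero] at this
      exact this
    · have := h l
      rwa [Function.update_of_ne hi] at this
  · intro c
    constructor
    · intro h l
      obtain ⟨y, hy⟩ := h j
      rw [Function.update_of_ne hij.symm] at hy
      obtain ⟨z, hz⟩ := h l
      rcases eq_or_ne l i with rfl | hi
      · rw [Function.update_self] at hz
        exact ⟨z - y, by push_cast; linarith⟩
      · rw [Function.update_of_ne hi] at hz
        exact ⟨z, hz⟩
    · intro h l
      obtain ⟨y, hy⟩ := h j
      obtain ⟨z, hz⟩ := h l
      rcases eq_or_ne l i with rfl | hi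
      · exact ⟨z + y, by rw [Function.update_self]; push_cast; linarith⟩
      · exact ⟨z, by rw [Function.update_of_ne hi]; exact hz⟩

theorem IsPrimitive.update_add' {k : ℕ} {b : Fin k → W} (hb : IsPrimitive M b) {i j : Fin k}
    (hij : i ≠ j) : IsPrimitive M (Function.update b i (b i + b j)) := by
  rw [add_comm]
  exact hb.update_add hij.symm

theorem sp_update_add' {k : ℕ} (b : Fin k → W) {i j : Fin k} (hij : i ≠ j) :
    sp (Function.update b i (b i + b j)) = sp b := by
  rw [add_comm]
  exact sp_update_add b hij.symm

theorem IsPrimitive.update_neg {k : ℕ} {b : Fin k → W} (hb : IsPrimitive M b) (i : Fin k) :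
    IsPrimitive M (Function.update b i (-b i)) := by
  refine hb.of_coordinates _ (fun c => sum_update_neg c b i) ?_ ?_
  · intro c h l
    have := h l
    rcases eq_or_ne l i with rfl | hi
    · simpa using this
    · simpa [hi] using this
  · intro c
    refine forall_congr' (fun l => ?_)
    rcases eq_or_ne l i with rfl | hi
    · simp only [Function.update_self]
      constructor
      · rintro ⟨z, hz⟩
        exact ⟨-z, by push_cast; linarith⟩
      · rintro ⟨z, hz⟩
        exact ⟨-z, by push_cast; linarith⟩
    · simp [hi]

theorem IsPrimitive.comp_perm {k : ℕ} {b : Fin k → W} (hb : IsPrimitive M b)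
    (σ : Equiv.Perm (Fin k)) : IsPrimitive M (b ∘ σ) := by
  refine hb.of_coordinates _ (fun c => sum_comp_perm c b σ) ?_ ?_
  · intro c h l
    simpa using h (σ l)
  · intro c
    constructor
    · intro h l
      simpa using h (σ l)
    · intro h l
      exact h _

theorem IsPrimitive.removeNth {k : ℕ} {w : Fin (k + 1) → W} (hw : IsPrimitive M w)
    (i : Fin (k + 1)) : IsPrimitive M (i.removeNth w) where
  linearIndependent := hw.linearIndependent.comp _ Fin.succAbove_right_injective
  mem_iff c := by
    rw [sum_removeNth, hw.mem_iff, Fin.forall_iff_succAbove i]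
    simp only [Fin.insertNth_apply_same, Fin.insertNth_apply_succAbove]
    exact and_iff_right ⟨0, by simp⟩

theorem IsPrimitive.mem {k : ℕ} {b : Fin k → W} (hb : IsPrimitive M b) (i : Fin k) : b i ∈ M := by
  have := (hb.mem_iff (Pi.single i 1)).mpr (fun l => by
    rcases eq_or_ne l i with rfl | h
    · exact ⟨1, by simp⟩
    · exact ⟨0, by simp [h]⟩)
  simpa [Pi.single_apply, Finset.sum_ite_eq'] using this

theorem isPrimitive_fin_zero (b : Fin 0 → W) : IsPrimitive M b where
  linearIndependent := linearIndependent_empty_type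
  mem_iff c := by simp [zero_mem]

end Primitive

/-! ### The group of symbols -/

section Symbols

variable {W : Type*} [AddCommGroup W] [Module ℚ W]

/-- The defining relators of the group of symbols. -/
inductive SymbRel (M : AddSubgroup W) (k : ℕ) : FreeAbelianGroup (Fin k → W) → Prop
  | degenerate (b : Fin k → W) : ¬ IsPrimitive M b → SymbRel M k (.of b)
  | add (b : Fin k → W) (i j : Fin k) : i ≠ j → IsPrimitive M b →
      SymbRel M k (.of b - (.of (Function.update b j (b i + b j)) +
        .of (Function.update b i (b i + b j))))
  | neg (b : Fin k → W) (i : Fin k) : IsPrimitive M b →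
      SymbRel M k (.of (Function.update b i (-b i)) - .of b)
  | perm (b : Fin k → W) (σ : Equiv.Perm (Fin k)) : IsPrimitive M b →
      SymbRel M k (.of (b ∘ σ) - (Equiv.Perm.sign σ : ℤ) • .of b)

/-- The abelian group generated by primitive `k`-tuples in `W` subject to Manin's three-term
relation, invariance under sign changes, and antisymmetry. It is the direct sum, over all rational
subspaces `U` of dimension `k`, of the group of symbols of `U`. -/
abbrev Symb (M : AddSubgroup W) (k : ℕ) : Type _ :=
  FreeAbelianGroup (Fin k → W) ⧸ AddSubgroup.closure {r | SymbRel M k r}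

/-- The symbol of a tuple; it vanishes unless the tuple is primitive. -/
def sym (M : AddSubgroup W) {k : ℕ} (b : Fin k → W) : Symb M k :=
  QuotientAddGroup.mk (.of b)

/-- Functions on tuples that factor through the group of symbols. -/
structure IsSymb (M : AddSubgroup W) {k : ℕ} {A : Type*} [AddCommGroup A]
    (f : (Fin k → W) → A) : Prop where
  degenerate : ∀ b, ¬ IsPrimitive M b → f b = 0
  add : ∀ b i j, i ≠ j → IsPrimitive M b →
    f b = f (Function.update b j (b i + b j)) + f (Function.update b i (b i + b j))
  neg : ∀ b i, IsPrimitive M b → f (Function.update b i (-b i)) = f b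
  perm : ∀ b (σ : Equiv.Perm (Fin k)), IsPrimitive M b →
    f (b ∘ σ) = (Equiv.Perm.sign σ : ℤ) • f b

variable {M : AddSubgroup W} {k : ℕ} {A : Type*} [AddCommGroup A]

/-- The homomorphism out of the group of symbols with given values on generators. -/
def Symb.lift (f : (Fin k → W) → A) (hf : IsSymb M f) : Symb M k →+ A :=
  QuotientAddGroup.lift _ (FreeAbelianGroup.lift f) (by
    rw [AddSubgroup.closure_le]
    rintro r (⟨b, hb⟩ | ⟨b, i, j, hij, hb⟩ | ⟨b, i, hb⟩ | ⟨b, σ, hb⟩)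
    · simpa using hf.degenerate b hb
    · simpa [sub_eq_zero] using hf.add b i j hij hb
    · simpa [sub_eq_zero] using hf.neg b i hb
    · simpa [sub_eq_zero] using hf.perm b σ hb)

@[simp]
theorem Symb.lift_sym (f : (Fin k → W) → A) (hf : IsSymb M f) (b : Fin k → W) :
    Symb.lift f hf (sym M b) = f b := by
  simp [Symb.lift, sym]

theorem isSymb_sym : IsSymb M (sym M : (Fin k → W) → Symb M k) where
  degenerate b hb := (QuotientAddGroup.eq_zero_iff _).mpr
    (AddSubgroup.subset_closure (.degenerate b hb))
  add b i j hij hb := by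
    rw [← sub_eq_zero]
    exact (QuotientAddGroup.eq_zero_iff _).mpr (AddSubgroup.subset_closure (.add b i j hij hb))
  neg b i hb := by
    rw [← sub_eq_zero]
    exact (QuotientAddGroup.eq_zero_iff _).mpr (AddSubgroup.subset_closure (.neg b i hb))
  perm b σ hb := by
    rw [← sub_eq_zero]
    exact (QuotientAddGroup.eq_zero_iff _).mpr (AddSubgroup.subset_closure (.perm b σ hb))

theorem Symb.induction {P : Symb M k → Prop} (x : Symb M k) (zero : P 0)
    (add : ∀ x y, P x → P y → P (x + y)) (neg : ∀ x, P x → P (-x))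
    (sym : ∀ b, IsPrimitive M b → P (sym M b)) : P x := by
  obtain ⟨y, rfl⟩ := QuotientAddGroup.mk_surjective x
  have hs : ∀ b, P (TitsSteinberg.sym M b) := fun b => by
    by_cases hb : IsPrimitive M b
    · exact sym b hb
    · rw [isSymb_sym.degenerate b hb]; exact zero
  induction y using FreeAbelianGroup.induction_on with
  | zero => exact zero
  | of b => exact hs b
  | neg b _ => exact neg _ (hs b)
  | add x y hx hy => exact add _ _ hx hy

theorem Symb.hom_ext {f g : Symb M k →+ A}
    (h : ∀ b, IsPrimitive M b → f (sym M b) = g (sym M b)) : f = g := by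
  refine AddMonoidHom.ext (fun x => ?_)
  induction x using Symb.induction with
  | zero => simp
  | add x y hx hy => simp [hx, hy]
  | neg x hx => simp [hx]
  | sym b hb => exact h b hb

-- All primitive tuples in one relation have the same span, so discarding the tuples by a condition
-- on the span respects the relations. This is the splitting of `Symb` over subspaces.
open Classical in
theorem IsSymb.filter {f : (Fin k → W) → A} (hf : IsSymb M f) (X : Submodule ℚ W → Prop) :
    IsSymb M (fun b => if X (sp b) then f b else 0) where
  degenerate b hb := by simp [hf.degenerate b hb]
  add b i j hij hb := by
    simp only [sp_update_add b hij, sp_update_add' b hij]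
    split_ifs
    · exact hf.add b i j hij hb
    · simp
  neg b i hb := by simp only [sp_update_neg, hf.neg b i hb]
  perm b σ hb := by
    simp only [sp_comp_perm]
    split_ifs
    · exact hf.perm b σ hb
    · simp

open Classical in
/-- The projector onto the symbols whose span satisfies `X`. -/
def Symb.proj (M : AddSubgroup W) (k : ℕ) (X : Submodule ℚ W → Prop) : Symb M k →+ Symb M k :=
  Symb.lift _ (isSymb_sym.filter X)

open Classical in
theorem Symb.proj_sym (X : Submodule ℚ W → Prop) (b : Fin k → W) :
    Symb.proj M k X (sym M b) = if X (sp b) then sym M b else 0 := by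
  simp [Symb.proj]

theorem Symb.proj_proj (X Y : Submodule ℚ W → Prop) (x : Symb M k) :
    Symb.proj M k X (Symb.proj M k Y x) = Symb.proj M k (fun U => X U ∧ Y U) x := by
  classical
  have : (Symb.proj M k X).comp (Symb.proj M k Y) = Symb.proj M k (fun U => X U ∧ Y U) := by
    refine Symb.hom_ext (fun b _ => ?_)
    by_cases hx : X (sp b) <;> by_cases hy : Y (sp b) <;> simp [Symb.proj_sym, hx, hy]
  exact DFunLike.congr_fun this x

/-- Quantifying over all `T` containing `S` allows the finite sets of two summands to be merged. -/
theorem Symb.exists_sum_proj (x : Symb M k) : ∃ S : Finset (Submodule ℚ W), ∀ T, S ⊆ T →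
    x = ∑ U ∈ T, Symb.proj M k (· = U) x := by
  classical
  induction x using Symb.induction with
  | zero => exact ⟨∅, fun T _ => by simp⟩
  | add x y hx hy =>
    obtain ⟨S, hS⟩ := hx
    obtain ⟨S', hS'⟩ := hy
    refine ⟨S ∪ S', fun T hT => ?_⟩
    simp only [map_add, Finset.sum_add_distrib]
    rw [← hS T (Finset.union_subset_left hT), ← hS' T (Finset.union_subset_right hT)]
  | neg x hx =>
    obtain ⟨S, hS⟩ := hx
    refine ⟨S, fun T hT => ?_⟩
    simp only [map_neg, Finset.sum_neg_distrib]
    rw [← hS T hT]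
  | sym b hb =>
    refine ⟨{sp b}, fun T hT => ?_⟩
    rw [Finset.sum_eq_single (sp b)]
    · simp [Symb.proj_sym]
    · intro U _ hU
      simp [Symb.proj_sym, hU.symm]
    · intro h
      exact absurd (hT (by simp)) h

/-- A symbol vanishes if all its components vanish. -/
theorem Symb.eq_zero_of_proj (x : Symb M k) (h : ∀ U, Symb.proj M k (· = U) x = 0) : x = 0 := by
  obtain ⟨S, hS⟩ := x.exists_sum_proj
  rw [hS S subset_rfl]
  exact Finset.sum_eq_zero (fun U _ => h U)

theorem sym_smul_units (b : Fin k → W) (hb : IsPrimitive M b) (ε : Fin k → ℤˣ) :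
    IsPrimitive M (fun i => (ε i : ℤ) • b i) ∧ sym M (fun i => (ε i : ℤ) • b i) = sym M b := by
  have key : ∀ s : Finset (Fin k),
      IsPrimitive M (fun i => if i ∈ s then (ε i : ℤ) • b i else b i) ∧
      sym M (fun i => if i ∈ s then (ε i : ℤ) • b i else b i) = sym M b := by
    intro s
    induction s using Finset.induction_on with
    | empty => simpa using hb
    | insert a s ha ih =>
      set b' := fun i => if i ∈ s then (ε i : ℤ) • b i else b i with hb'
      rcases Int.units_eq_one_or (ε a) with h | h
      · have : (fun i => if i ∈ insert a s then (ε i : ℤ) • b i else b i) = b' := by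
          funext i
          rcases eq_or_ne i a with rfl | hi
          · simp [hb', h]
          · simp [hb', hi]
        rw [this]; exact ih
      · have : (fun i => if i ∈ insert a s then (ε i : ℤ) • b i else b i) =
            Function.update b' a (-b' a) := by
          funext i
          rcases eq_or_ne i a with rfl | hi
          · simp [hb', h, ha]
          · simp [hb', hi]
        rw [this]
        exact ⟨ih.1.update_neg a, by rw [isSymb_sym.neg _ _ ih.1, ih.2]⟩
  simpa using key Finset.univ

end Symbols

/-! ### The residue map -/

section Residue

variable {W : Type*} [AddCommGroup W] [Module ℚ W] {M : AddSubgroup W} {k : ℕ}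

/-- In the three-term relation, omitting an entry other than `i`, `j` yields the three-term relation
of the face. Among the remaining terms, two are the faces of `w` itself, and the two that retain the
sum of the vectors differ by an odd rearrangement and cancel. The test for primitivity is essential,
since a non-primitive tuple may have primitive faces. -/
theorem isSymb_residue : IsSymb M (fun w : Fin (k + 1) → W =>
    open Classical in
    if IsPrimitive M w then
      ∑ i : Fin (k + 1), (-1 : ℤ) ^ (i : ℕ) • sym M (i.removeNth w) else 0) where
  degenerate w hw := if_neg hw
  perm w σ hw := by
    simp only [if_pos hw, if_pos (hw.comp_perm σ)]
    rw [Finset.smul_sum, ← Equiv.sum_comp σ (fun i => (Equiv.Perm.sign σ : ℤ) • (-1 : ℤ) ^ (i : ℕ) •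
      sym M (i.removeNth w))]
    refine Finset.sum_congr rfl (fun i _ => ?_)
    obtain ⟨τ, h1, h2⟩ := exists_removeNth_comp_perm (α := W) σ i
    rw [h1, isSymb_sym.perm _ _ (hw.removeNth _), smul_smul, smul_smul, h2]
  neg w i hw := by
    simp only [if_pos hw, if_pos (hw.update_neg i)]
    refine Finset.sum_congr rfl (fun l _ => ?_)
    rcases Fin.eq_self_or_eq_succAbove l i with rfl | ⟨j, rfl⟩
    · rw [Fin.removeNth_update]
    · rw [Fin.removeNth_update_succAbove]
      congr 1
      exact isSymb_sym.neg (l.removeNth w) j (hw.removeNth l)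
  add w i j hij hw := by
    simp only [if_pos hw, if_pos (hw.update_add hij), if_pos (hw.update_add' hij)]
    rw [← Finset.sum_add_distrib]
    set s := w i + w j with hs
    set w₁ := Function.update w j s with hw₁
    set w₂ := Function.update w i s with hw₂
    -- the two terms in which the sum of the two vectors survives alone cancel
    have hcancel : (-1 : ℤ) ^ (i : ℕ) • sym M (i.removeNth w₁) +
        (-1 : ℤ) ^ (j : ℕ) • sym M (j.removeNth w₂) = 0 := by
      have e : j.removeNth w₂ = j.removeNth (w₁ ∘ Equiv.swap i j) := by
        funext l
        have hl : j.succAbove l ≠ j := Fin.succAbove_ne j l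
        simp only [Fin.removeNth, hw₁, hw₂, Function.comp_apply]
        rcases eq_or_ne (j.succAbove l) i with h | h
        · rw [h, Equiv.swap_apply_left, Function.update_self, Function.update_self]
        · rw [Equiv.swap_apply_of_ne_of_ne h hl, Function.update_of_ne h, Function.update_of_ne hl]
      obtain ⟨τ, h1, h2⟩ := exists_removeNth_comp_perm (α := W) (Equiv.swap i j) j
      rw [e, h1, isSymb_sym.perm _ _ ((hw.update_add hij).removeNth _), smul_smul, h2,
        Equiv.Perm.sign_swap hij, Equiv.swap_apply_right]
      simp [hw₁, hs]
    have hi : i.removeNth w₂ = i.removeNth w := Fin.removeNth_update ..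
    have hj : j.removeNth w₁ = j.removeNth w := Fin.removeNth_update ..
    have hrest : ∀ l, l ≠ i → l ≠ j → sym M (l.removeNth w) =
        sym M (l.removeNth w₁) + sym M (l.removeNth w₂) := by
      intro l hli hlj
      obtain ⟨i', rfl⟩ := Fin.exists_succAbove_eq hli.symm
      obtain ⟨j', rfl⟩ := Fin.exists_succAbove_eq hlj.symm
      have hij' : i' ≠ j' := fun h => hij (by rw [h])
      rw [hw₁, hw₂, Fin.removeNth_update_succAbove, Fin.removeNth_update_succAbove]
      exact isSymb_sym.add (l.removeNth w) i' j' hij' (hw.removeNth l)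
    rw [← sub_eq_zero, ← Finset.sum_sub_distrib]
    rw [← Finset.sum_subset (Finset.subset_univ {i, j}), Finset.sum_pair hij, hi, hj]
    · rw [← neg_eq_zero, ← hcancel]
      abel
    · intro l _ hl
      simp only [Finset.mem_insert, Finset.mem_singleton, not_or] at hl
      rw [hrest l hl.1 hl.2, smul_add, sub_self]

/-- The total residue, `[w₀, …, w_k] ↦ ∑ i, (-1)^i [w₀, …, ŵ_i, …, w_k]`. -/
def residue (M : AddSubgroup W) (k : ℕ) : Symb M (k + 1) →+ Symb M k :=
  Symb.lift _ isSymb_residue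

theorem residue_sym {w : Fin (k + 1) → W} (hw : IsPrimitive M w) :
    residue M k (sym M w) = ∑ i : Fin (k + 1), (-1 : ℤ) ^ (i : ℕ) • sym M (i.removeNth w) := by
  rw [residue, Symb.lift_sym, if_pos hw]

theorem residue_residue (x : Symb M (k + 1 + 1)) : residue M k (residue M (k + 1) x) = 0 := by
  have h : (residue M k).comp (residue M (k + 1)) = 0 := by
    refine Symb.hom_ext (fun w hw => ?_)
    simp only [AddMonoidHom.comp_apply, residue_sym hw, map_sum, map_zsmul, AddMonoidHom.zero_apply,
      residue_sym (hw.removeNth _), Finset.smul_sum, smul_smul]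
    rw [← Finset.sum_product']
    refine Finset.sum_involution
      (fun p _ => (p.1.succAbove p.2, p.2.predAbove p.1)) ?_ ?_ ?_ ?_
    · rintro ⟨i, j⟩ _
      have hf : (j.predAbove i).removeNth ((i.succAbove j).removeNth w) =
          j.removeNth (i.removeNth w) := by
        funext l
        exact congrArg w (Fin.succAbove_succAbove_succAbove_predAbove i j l)
      simp only [hf]
      rw [← add_smul, ← pow_add, ← pow_add, Fin.neg_one_pow_succAbove_add_predAbove]
      simp
    · rintro ⟨i, j⟩ _ _ h
      exact Fin.succAbove_ne i j (congrArg Prod.fst h)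
    · intro p _
      exact Finset.mem_univ _
    · rintro ⟨i, j⟩ _
      exact Prod.ext (Fin.succAbove_succAbove_predAbove i j)
        (Fin.predAbove_predAbove_succAbove i j)
  exact DFunLike.congr_fun h x

end Residue

/-! ### The index of a hyperplane relative to a vector -/

section Index

variable {W : Type*} [AddCommGroup W] [Module ℚ W] {M : AddSubgroup W} {k : ℕ}

theorem sum_cast_smul {k : ℕ} (a : Fin k → ℤ) (w : Fin k → W) :
    ∑ i, (a i : ℚ) • w i = ∑ i, a i • w i := by
  simp only [Int.cast_smul_eq_zsmul]

theorem IsPrimitive.sum_mem {b : Fin k → W} (hb : IsPrimitive M b) (a : Fin k → ℤ) :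
    ∑ i, a i • b i ∈ M :=
  _root_.sum_mem (fun i _ => zsmul_mem (hb.mem i) _)

theorem IsPrimitive.exists_eq_sum {b : Fin k → W} (hb : IsPrimitive M b) {x : W} (hx : x ∈ M)
    (hxb : x ∈ sp b) : ∃ a : Fin k → ℤ, x = ∑ i, a i • b i := by
  obtain ⟨c, rfl⟩ := mem_sp_iff.mp hxb
  choose a ha using (hb.mem_iff c).mp hx
  exact ⟨a, by rw [← sum_cast_smul]; simp only [ha]⟩

theorem sum_mem_sp (a : Fin k → ℤ) (w : Fin k → W) : ∑ i, a i • w i ∈ sp w :=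
  sum_mem (fun i _ => zsmul_mem (Submodule.subset_span (Set.mem_range_self i)) _)

theorem sum_mem_sp_removeNth_iff {w : Fin (k + 1) → W} (hw : LinearIndependent ℚ w)
    (i : Fin (k + 1)) (a : Fin (k + 1) → ℤ) : ∑ l, a l • w l ∈ sp (i.removeNth w) ↔ a i = 0 := by
  rw [mem_sp_iff]
  constructor
  · rintro ⟨c, hc⟩
    rw [sum_removeNth, ← sum_cast_smul, ← sub_eq_zero, ← Finset.sum_sub_distrib] at hc
    simp only [← sub_smul] at hc
    have := Fintype.linearIndependent_iff.mp hw _ hc i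
    simpa using this
  · intro h
    refine ⟨fun l => a (i.succAbove l), ?_⟩
    rw [Fin.sum_univ_succAbove _ i, h, zero_smul, zero_add]
    simp [Fin.removeNth, Int.cast_smul_eq_zsmul]

/-- The largest `d` such that `e` is `d` times a lattice vector modulo `H`. -/
def index (M : AddSubgroup W) (e : W) (H : Submodule ℚ W) : ℕ :=
  sSup {d : ℕ | ∃ v ∈ M, e - (d : ℤ) • v ∈ H}

/-- Modulo the hyperplane, the lattice vectors in `sp w` are the multiples of `w i`, and the given
vector is `a i` times this generator. A competing `v` is forced into `sp w` because a nonzero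
multiple of it lies there, so its `d` divides `a i`. -/
theorem index_removeNth {w : Fin (k + 1) → W} (hw : IsPrimitive M w) (i : Fin (k + 1))
    {a : Fin (k + 1) → ℤ} (hi : a i ≠ 0) :
    index M (∑ l, a l • w l) (sp (i.removeNth w)) = (a i).natAbs := by
  apply IsGreatest.csSup_eq
  constructor
  · refine ⟨(a i).sign • w i, zsmul_mem (hw.mem i) _, ?_⟩
    rw [smul_smul, mul_comm, Int.sign_mul_natAbs]
    rw [Fin.sum_univ_succAbove _ i, add_sub_cancel_left]
    exact sum_mem_sp (fun l => a (i.succAbove l)) (i.removeNth w)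
  · rintro d ⟨v, hv, hd⟩
    rcases Nat.eq_zero_or_pos d with rfl | hpos
    · exact Nat.zero_le _
    have hle : sp (i.removeNth w) ≤ sp w := Submodule.span_mono (by
      rintro _ ⟨l, rfl⟩; exact ⟨_, rfl⟩)
    have hvw : v ∈ sp w := by
      have h1 : (d : ℤ) • v ∈ sp w := by
        have := sub_mem (sum_mem_sp a w) (hle hd)
        simpa using this
      rw [← Int.cast_smul_eq_zsmul ℚ] at h1
      exact (Submodule.smul_mem_iff _ (by exact_mod_cast hpos.ne')).mp h1
    obtain ⟨m, rfl⟩ := hw.exists_eq_sum hv hvw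
    rw [Finset.smul_sum, ← Finset.sum_sub_distrib] at hd
    simp only [smul_smul, ← sub_smul] at hd
    have := (sum_mem_sp_removeNth_iff hw.linearIndependent i (fun l => a l - d * m l)).mp hd
    have hdvd : (d : ℤ) ∣ a i := ⟨m i, by linarith⟩
    exact Nat.le_of_dvd (Int.natAbs_pos.mpr hi) (Int.natCast_dvd.mp hdvd)

/-- Vectors `v` completing a primitive tuple `b` to a primitive tuple whose span contains `e`,
such that the coordinates of `e` along `b` are reduced modulo the coordinate along `v`. -/
structure IsCompletion (M : AddSubgroup W) (e : W) (b : Fin k → W) (v : W)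
    (d : ℤ) (a : Fin k → ℤ) : Prop where
  primitive : IsPrimitive M (Fin.cons v b : Fin (k + 1) → W)
  nonneg : ∀ i, 0 ≤ a i
  lt : ∀ i, a i < d
  eq : e = d • v + ∑ i, a i • b i
  pos : 0 < d

theorem IsCompletion.eq_cons {e : W} {b : Fin k → W} {v : W} {d : ℤ} {a : Fin k → ℤ}
    (h : IsCompletion M e b v d a) :
    e = ∑ l, (Fin.cons d a : Fin (k + 1) → ℤ) l • (Fin.cons v b : Fin (k + 1) → W) l := by
  rw [Fin.sum_univ_succ]
  simpa using h.eq

theorem IsCompletion.index_eq {e : W} {b : Fin k → W} {v : W} {d : ℤ} {a : Fin k → ℤ}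
    (h : IsCompletion M e b v d a) : index M e (sp b) = d.natAbs := by
  have := index_removeNth h.primitive 0 (a := Fin.cons d a) (by simpa using h.pos.ne')
  rw [← h.eq_cons] at this
  simpa using this

/-- Both multipliers equal the index. Then `d • (v - v')` has coordinates `a' - a` along `b`; these
are divisible by `d`, as `v - v'` is a lattice vector, and smaller than `d` in absolute value, hence
zero. -/
theorem IsCompletion.unique {e : W} {b : Fin k → W} {v v' : W} {d d' : ℤ} {a a' : Fin k → ℤ}
    (h : IsCompletion M e b v d a) (h' : IsCompletion M e b v' d' a') : v = v' ∧ d = d' := by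
  have hd : d = d' := by
    have := h.index_eq.symm.trans h'.index_eq
    have := h.pos
    have := h'.pos
    omega
  subst hd
  refine ⟨?_, rfl⟩
  have hb : IsPrimitive M b := by simpa using h.primitive.removeNth 0
  have hd0 : (d : ℚ) ≠ 0 := by exact_mod_cast h.pos.ne'
  have e1 : (d : ℚ) • (v - v') = ∑ i, ((a' i - a i : ℤ) : ℚ) • b i := by
    have := h.eq.symm.trans h'.eq
    rw [sum_cast_smul, Int.cast_smul_eq_zsmul]
    simp only [sub_smul, smul_sub, Finset.sum_sub_distrib]
    rw [sub_eq_sub_iff_add_eq_add, this, add_comm]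
  have e2 : v - v' = ∑ i, (((a' i - a i : ℤ) : ℚ) / d) • b i := by
    have := congrArg (fun x => (d : ℚ)⁻¹ • x) e1
    simp only [smul_smul, inv_mul_cancel₀ hd0, one_smul, Finset.smul_sum] at this
    rw [this]
    refine Finset.sum_congr rfl (fun i _ => ?_)
    rw [div_eq_inv_mul]
  have hM : v - v' ∈ M := sub_mem (by simpa using h.primitive.mem 0)
    (by simpa using h'.primitive.mem 0)
  rw [e2, hb.mem_iff] at hM
  have hz : ∀ i, a' i - a i = 0 := by
    intro i
    obtain ⟨z, hz⟩ := hM i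
    rw [div_eq_iff hd0] at hz
    have hz' : a' i - a i = z * d := by exact_mod_cast hz
    have h1 := h.nonneg i
    have h2 := h.lt i
    have h3 := h'.nonneg i
    have h4 := h'.lt i
    have hz0 : z = 0 := by
      by_contra hne
      rcases lt_or_gt_of_ne hne with hlt | hgt
      · nlinarith
      · nlinarith
    rw [hz', hz0, zero_mul]
  rw [← sub_eq_zero, e2]
  exact Finset.sum_eq_zero (fun i _ => by rw [hz i]; simp)

/-- `M` is a full lattice, in the weak form used below: linear functionals are integral on `M` up
to a scalar, and every vector has a nonzero multiple in `M`. -/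
structure IsLatticeIn (M : AddSubgroup W) : Prop where
  exists_integral : ∀ φ : W →ₗ[ℚ] ℚ, ∃ D : ℤ, D ≠ 0 ∧ ∀ x ∈ M, ∃ z : ℤ, D * φ x = z
  exists_smul_mem : ∀ x : W, ∃ D : ℤ, D ≠ 0 ∧ D • x ∈ M

/-- The functional reads off the coordinate along `v` as φ x / φ v, which is integral by `hdvd`.
What remains after subtracting that multiple of `v` is governed by the primitivity of `b`. -/
theorem IsPrimitive.cons {b : Fin k → W} (hb : IsPrimitive M b) {v : W} (hv : v ∈ M)
    (φ : W →ₗ[ℚ] ℚ) (hφ : ∀ i, φ (b i) = 0) (hφv : φ v ≠ 0)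
    (hdvd : ∀ x ∈ M, x ∈ sp (Fin.cons v b : Fin (k + 1) → W) → ∃ z : ℤ, φ x = z * φ v) :
    IsPrimitive M (Fin.cons v b : Fin (k + 1) → W) where
  linearIndependent := by
    rw [linearIndependent_finCons]
    refine ⟨hb.linearIndependent, fun h => hφv ?_⟩
    have : sp b ≤ LinearMap.ker φ := by
      rw [Submodule.span_le]
      rintro _ ⟨i, rfl⟩
      exact hφ i
    exact this h
  mem_iff c := by
    rw [Fin.forall_fin_succ]
    constructor
    · intro h
      obtain ⟨z, hz⟩ := hdvd _ h (mem_sp_iff.mpr ⟨c, rfl⟩)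
      have hz' : c 0 = z := by
        rw [Fin.sum_univ_succ] at hz
        simp only [Fin.cons_zero, Fin.cons_succ, map_add, map_sum, map_smul, hφ, smul_eq_mul,
          mul_zero, Finset.sum_const_zero, add_zero] at hz
        exact mul_right_cancel₀ hφv hz
      refine ⟨⟨z, hz'⟩, ?_⟩
      rw [← hb.mem_iff (fun i => c i.succ)]
      rw [Fin.sum_univ_succ] at h
      simp only [Fin.cons_zero, Fin.cons_succ, hz', Int.cast_smul_eq_zsmul] at h
      exact (AddSubgroup.add_mem_cancel_left M (zsmul_mem hv z)).mp h
    · rintro ⟨⟨z, hz⟩, h⟩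
      rw [Fin.sum_univ_succ]
      simp only [Fin.cons_zero, Fin.cons_succ, hz, Int.cast_smul_eq_zsmul]
      exact add_mem (zsmul_mem hv z) ((hb.mem_iff (fun i => c i.succ)).mpr h)

/-- A functional that kills `b` but not `e`, scaled to be integral on `M`, takes on `M ∩ U` the
values of a cyclic group gℤ. A lattice vector of value `g`, up to sign, completes `b`, and division
with remainder normalizes it. -/
theorem IsPrimitive.exists_completion (hM : IsLatticeIn M) {b : Fin k → W} (hb : IsPrimitive M b)
    {e : W} (he : e ∈ M) (heb : e ∉ sp b) : ∃ v d a, IsCompletion M e b v d a := by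
  obtain ⟨φ₀, hφ₀, hle⟩ := Submodule.exists_le_ker_of_notMem heb
  obtain ⟨D, hD, hint⟩ := hM.exists_integral φ₀
  set φ : W →ₗ[ℚ] ℚ := (D : ℚ) • φ₀ with hφ
  have hφe : φ e ≠ 0 := by simp [hφ, hD, hφ₀]
  have hφb : ∀ x ∈ sp b, φ x = 0 := fun x hx => by
    have : φ₀ x = 0 := hle hx
    simp [hφ, this]
  have hφb' : ∀ i, φ (b i) = 0 := fun i => hφb _ (Submodule.subset_span ⟨i, rfl⟩)
  set U := sp (Fin.cons e b : Fin (k + 1) → W) with hU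
  let S : AddSubgroup ℤ :=
    { carrier := {z | ∃ x ∈ M, x ∈ U ∧ φ x = z}
      zero_mem' := ⟨0, zero_mem _, zero_mem _, by simp⟩
      add_mem' := by
        rintro y z ⟨x, hx, hxU, hx'⟩ ⟨x', h, h', h''⟩
        exact ⟨x + x', add_mem hx h, add_mem hxU h', by simp [hx', h'']⟩
      neg_mem' := by
        rintro y ⟨x, hx, hxU, hx'⟩
        exact ⟨-x, neg_mem hx, neg_mem hxU, by simp [hx']⟩ }
  obtain ⟨g, hg⟩ := Int.subgroup_cyclic S
  have hdvd : ∀ x ∈ M, x ∈ U → ∃ z : ℤ, φ x = z * g := by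
    intro x hx hxU
    obtain ⟨y, hy⟩ := hint x hx
    have hyS : y ∈ S := ⟨x, hx, hxU, by simpa [hφ] using hy⟩
    rw [hg, AddSubgroup.mem_closure_singleton] at hyS
    obtain ⟨z, hz⟩ := hyS
    refine ⟨z, ?_⟩
    have : φ x = y := by simpa [hφ] using hy
    rw [this, ← hz]
    simp
  have heU : e ∈ U := Submodule.subset_span ⟨0, by simp⟩
  have hbU : ∀ i, b i ∈ U := fun i => Submodule.subset_span ⟨i.succ, by simp⟩
  obtain ⟨v₀, hv₀, hv₀U, hv₀g⟩ : g ∈ S := by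
    rw [hg]; exact AddSubgroup.mem_closure_singleton_self g
  obtain ⟨d₀, hd₀⟩ := hdvd e he heU
  have hd₀0 : d₀ ≠ 0 := by
    rintro rfl
    exact hφe (by simpa using hd₀)
  have hg0 : (g : ℚ) ≠ 0 := by
    intro h
    exact hφe (by rw [hd₀, h, mul_zero])
  -- choose the sign so that the coordinate of `e` is positive
  set v₁ : W := d₀.sign • v₀ with hv₁
  set d : ℤ := (d₀.natAbs : ℤ) with hd
  have hsd : d₀.sign * d = d₀ := Int.sign_mul_natAbs d₀
  have hss : d₀.sign * d₀.sign = 1 := by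
    rcases lt_or_gt_of_ne hd₀0 with h | h
    · simp [Int.sign_eq_neg_one_of_neg h]
    · simp [Int.sign_eq_one_of_pos h]
  have hdpos : 0 < d := by omega
  have hφv₁ : φ v₁ = d₀.sign * g := by
    rw [hv₁, map_zsmul, hv₀g]; simp
  -- every vector of `U` in the kernel of `φ` is in the span of `b`
  have hker : ∀ x ∈ U, φ x = 0 → x ∈ sp b := by
    intro x hx hx0
    obtain ⟨c, rfl⟩ := mem_sp_iff.mp hx
    rw [Fin.sum_univ_succ] at hx0 ⊢
    simp only [Fin.cons_zero, Fin.cons_succ, map_add, map_sum, map_smul, hφb', smul_eq_mul,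
      mul_zero, Finset.sum_const_zero, add_zero] at hx0
    have : c 0 = 0 := (mul_eq_zero.mp hx0).resolve_right hφe
    simp only [Fin.cons_zero, Fin.cons_succ, this, zero_smul, zero_add]
    exact mem_sp_iff.mpr ⟨fun i => c i.succ, rfl⟩
  have hrem : e - d • v₁ ∈ sp b := by
    refine hker _ (sub_mem heU (zsmul_mem (zsmul_mem hv₀U _) _)) ?_
    rw [map_sub, map_zsmul, hφv₁, hd₀, zsmul_eq_mul, ← mul_assoc]
    rw [show (d : ℚ) * (d₀.sign : ℚ) = d₀ by rw [mul_comm]; exact_mod_cast hsd, sub_self]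
  obtain ⟨a, ha⟩ := hb.exists_eq_sum
    (sub_mem he (zsmul_mem (zsmul_mem hv₀ _) _)) hrem
  -- Moving the quotients `a i / d` into `v` leaves the remainders `a i % d` as coordinates along
  -- `b`.
  set v : W := v₁ + ∑ i, (a i / d) • b i with hv
  have hvM : v ∈ M := add_mem (zsmul_mem hv₀ _) (hb.sum_mem _)
  have hvU : v ∈ U := add_mem (zsmul_mem hv₀U _) (_root_.sum_mem (fun i _ => zsmul_mem (hbU i) _))
  have hφv : φ v = d₀.sign * g := by
    rw [hv, map_add, hφv₁, hφb _ (sum_mem_sp _ _), add_zero]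
  refine ⟨v, d, fun i => a i % d, ?_, fun i => Int.emod_nonneg _ hdpos.ne',
    fun i => Int.emod_lt_of_pos _ hdpos, ?_, hdpos⟩
  · have hs0 : (d₀.sign : ℚ) ≠ 0 := by
      exact_mod_cast (Int.sign_eq_zero_iff_zero.not.mpr hd₀0)
    refine hb.cons hvM φ hφb' (by rw [hφv]; exact mul_ne_zero hs0 hg0) ?_
    intro x hx hxs
    have hxU : x ∈ U := by
      refine (Submodule.span_le.mpr ?_ : sp (Fin.cons v b : Fin (k + 1) → W) ≤ U) hxs
      rintro _ ⟨i, rfl⟩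
      refine Fin.cases ?_ (fun i => ?_) i
      · simpa using hvU
      · simpa using hbU i
    obtain ⟨z, hz⟩ := hdvd x hx hxU
    refine ⟨z * d₀.sign, ?_⟩
    have : (d₀.sign : ℚ) * d₀.sign = 1 := by exact_mod_cast hss
    rw [hz, hφv]
    push_cast
    linear_combination (-(z : ℚ) * g) * this
  · rw [hv, smul_add, add_assoc, Finset.smul_sum, ← Finset.sum_add_distrib]
    simp only [smul_smul, ← add_smul, Int.mul_ediv_add_emod]
    rw [← ha]
    abel

open Classical in
/-- The normalized completion of `b` relative to `e`. -/
def completion (M : AddSubgroup W) (e : W) (b : Fin k → W) : W :=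
  if h : ∃ v d a, IsCompletion M e b v d a then h.choose else 0

theorem IsCompletion.completion_eq {e : W} {b : Fin k → W} {v : W} {d : ℤ} {a : Fin k → ℤ}
    (h : IsCompletion M e b v d a) : completion M e b = v := by
  have hex : ∃ v d a, IsCompletion M e b v d a := ⟨v, d, a, h⟩
  obtain ⟨d', a', h'⟩ := hex.choose_spec
  rw [completion, dif_pos hex]
  exact (h'.unique h).1

end Index

/-! ### Residues along the hyperplanes that avoid a vector -/

section ResidueAt

variable {W : Type*} [AddCommGroup W] [Module ℚ W] {M : AddSubgroup W} {k : ℕ}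

/-- The part of the residue supported on subspaces that do not contain `e`. -/
def residueAt (M : AddSubgroup W) (k : ℕ) (e : W) : Symb M (k + 1) →+ Symb M k :=
  (Symb.proj M k (e ∉ ·)).comp (residue M k)

open Classical in
theorem residueAt_sym {e : W} {w : Fin (k + 1) → W} (hw : IsPrimitive M w) :
    residueAt M k e (sym M w) = ∑ i : Fin (k + 1), (-1 : ℤ) ^ (i : ℕ) •
      if e ∉ sp (i.removeNth w) then sym M (i.removeNth w) else 0 := by
  simp [residueAt, residue_sym hw, Symb.proj_sym]

/-- Descent on the index. The face of `[v, b]` opposite to `v` is `b`. Each other face either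
contains `e`, and is ignored, or has index `a i < d`, and is a residue by induction; subtracting
preimages of these leaves `b`. -/
theorem exists_residueAt_eq_sym (hM : IsLatticeIn M) {e : W} (he : e ∈ M) (b : Fin k → W)
    (hb : IsPrimitive M b) (heb : e ∉ sp b) :
    ∃ x, Symb.proj M (k + 1) (e ∈ ·) x = x ∧ residueAt M k e x = sym M b := by
  classical
  induction hn : index M e (sp b) using Nat.strong_induction_on generalizing b with
  | _ n ih =>
    obtain ⟨v, d, a, h⟩ := hb.exists_completion hM he heb
    set w : Fin (k + 1) → W := Fin.cons v b with hw
    have key : ∀ i : Fin k, ∃ x, Symb.proj M (k + 1) (e ∈ ·) x = x ∧ residueAt M k e x =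
        if e ∉ sp (i.succ.removeNth w) then sym M (i.succ.removeNth w) else 0 := by
      intro i
      by_cases hi : e ∈ sp (i.succ.removeNth w)
      · exact ⟨0, by simp, by simp [hi]⟩
      · rw [if_pos hi]
        have hi' := hi
        rw [h.eq_cons, sum_mem_sp_removeNth_iff h.primitive.linearIndependent] at hi'
        refine ih (a i).natAbs ?_ _ (h.primitive.removeNth _) hi ?_
        · rw [← hn, h.index_eq]
          have := h.nonneg i
          have := h.lt i
          omega
        · have := index_removeNth h.primitive i.succ (a := Fin.cons d a) hi'
          rw [← h.eq_cons] at this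
          simpa using this
    choose x hx hx' using key
    refine ⟨sym M w - ∑ i : Fin k, (-1 : ℤ) ^ (i.succ : ℕ) • x i, ?_, ?_⟩
    · have hew : e ∈ sp w := by
        rw [h.eq_cons]
        exact sum_mem_sp _ _
      simp [Symb.proj_sym, hew, hx]
    · rw [map_sub, residueAt_sym h.primitive, Fin.sum_univ_succ]
      simp only [map_sum, map_zsmul, hx']
      rw [add_sub_cancel_right]
      simp [heb]

/-- Every symbol on subspaces avoiding `e` is the residue of a symbol on subspaces containing
`e`. -/
theorem exists_residueAt_eq (hM : IsLatticeIn M) {e : W} (he : e ∈ M) (y : Symb M k) :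
    ∃ x, Symb.proj M (k + 1) (e ∈ ·) x = x ∧ residueAt M k e x = Symb.proj M k (e ∉ ·) y := by
  classical
  induction y using Symb.induction with
  | zero => exact ⟨0, by simp, by simp⟩
  | add y z hy hz =>
    obtain ⟨x, h1, h2⟩ := hy
    obtain ⟨x', h1', h2'⟩ := hz
    exact ⟨x + x', by rw [map_add, h1, h1'], by rw [map_add, map_add, h2, h2']⟩
  | neg y hy =>
    obtain ⟨x, h1, h2⟩ := hy
    exact ⟨-x, by rw [map_neg, h1], by rw [map_neg, map_neg, h2]⟩
  | sym b hb =>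
    rw [Symb.proj_sym]
    by_cases h : e ∈ sp b
    · exact ⟨0, by simp, by simp [h]⟩
    · rw [if_pos h]
      exact exists_residueAt_eq_sym hM he b hb h

theorem sum_update_coeff {V : Type*} [AddCommGroup V] (a : Fin k → ℤ) (b : Fin k → V) (i : Fin k) (x : ℤ) :
    ∑ l, Function.update a i x l • b l = ∑ l, a l • b l + (x - a i) • b i := by
  rw [← sub_eq_iff_eq_add', ← Finset.sum_sub_distrib, Finset.sum_eq_single i]
  · simp [sub_smul]
  · intro l _ hl
    simp [hl]
  · simp

/-! ### Normalized completions respect the relations between symbols -/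

section Completion

variable {e : W} {B : Type*} [AddCommGroup B] (g : Symb M (k + 1) →+ B) (d : ℕ)

open Classical in
/-- The value of `g` on the normalized completion of a tuple of index `d`. -/
def completionValue (e : W) (b : Fin k → W) : B :=
  if IsPrimitive M b ∧ e ∉ sp b ∧ index M e (sp b) = d then
    g (sym M (Fin.cons (completion M e b) b : Fin (k + 1) → W)) else 0

variable {g d}

theorem IsCompletion.isPrimitive {b : Fin k → W} {v : W} {d : ℤ} {a : Fin k → ℤ}
    (h : IsCompletion M e b v d a) : IsPrimitive M b := by
  simpa using h.primitive.removeNth 0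

theorem IsCompletion.notMem {b : Fin k → W} {v : W} {d : ℤ} {a : Fin k → ℤ}
    (h : IsCompletion M e b v d a) : e ∉ sp b := by
  have := sum_mem_sp_removeNth_iff h.primitive.linearIndependent 0 (Fin.cons d a)
  rw [← h.eq_cons] at this
  simp only [Fin.removeNth_zero, Fin.tail_cons, Fin.cons_zero] at this
  rw [this]
  exact h.pos.ne'

theorem IsCompletion.completionValue_eq {b : Fin k → W} {v : W} {a : Fin k → ℤ}
    (h : IsCompletion M e b v d a) :
    completionValue g d e b = g (sym M (Fin.cons v b : Fin (k + 1) → W)) := by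
  rw [completionValue, if_pos ⟨h.isPrimitive, h.notMem, by simpa using h.index_eq⟩,
    h.completion_eq]

theorem exists_isCompletion (hM : IsLatticeIn M) (he : e ∈ M) {b : Fin k → W}
    (h : IsPrimitive M b ∧ e ∉ sp b ∧ index M e (sp b) = d) :
    ∃ v a, IsCompletion M e b v d a := by
  obtain ⟨v, d', a, hc⟩ := h.1.exists_completion hM he h.2.1
  have h1 := hc.index_eq
  have h2 := hc.pos
  have : d' = d := by omega
  subst this
  exact ⟨v, a, hc⟩

/-- Only the normalization of `v` can change. If `a i = 0`, then `v` stays. Otherwise d v + a_i b_i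
= d (v + b_i) + (d - a_i)(-b_i), so the new completion is `v + b i`. The two values differ by `g` of
the tuple with entries v, v + b_i, which `g` kills. -/
theorem completionValue_neg (hM : IsLatticeIn M) (he : e ∈ M)
    (hg : ∀ w, IsPrimitive M w → ∀ a : Fin (k + 1) → ℤ, e = ∑ i, a i • w i →
      (∀ i, |a i| < d) → g (sym M w) = 0) (b : Fin k → W) (i : Fin k) (hb : IsPrimitive M b) :
    completionValue g d e (Function.update b i (-b i)) = completionValue g d e b := by
  by_cases hP : IsPrimitive M b ∧ e ∉ sp b ∧ index M e (sp b) = d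
  swap
  · have hP' : ¬ (IsPrimitive M (Function.update b i (-b i)) ∧
        e ∉ sp (Function.update b i (-b i)) ∧
        index M e (sp (Function.update b i (-b i))) = d) := by
      rw [sp_update_neg]
      exact fun h => hP ⟨hb, h.2⟩
    rw [completionValue, completionValue, if_neg hP, if_neg hP']
  obtain ⟨v, a, h⟩ := exists_isCompletion hM he hP
  have hw := h.primitive
  set w : Fin (k + 1) → W := Fin.cons v b with hwdef
  rw [h.completionValue_eq]
  rcases (h.nonneg i).eq_or_lt with h0 | hpos
  · have h' : IsCompletion M e (Function.update b i (-b i)) v d a := by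
      refine ⟨?_, h.nonneg, h.lt, ?_, h.pos⟩
      · have := hw.update_neg i.succ
        rwa [hwdef, Fin.cons_succ, ← Fin.cons_update] at this
      · rw [sum_update_neg, sum_update_coeff, ← h0]
        simpa using h.eq
    rw [h'.completionValue_eq, Fin.cons_update]
    have := isSymb_sym.neg w i.succ hw
    rw [hwdef, Fin.cons_succ] at this
    rw [this]
  · have hne : (0 : Fin (k + 1)) ≠ i.succ := (Fin.succ_ne_zero i).symm
    have hw₀ := hw.update_add' hne
    have e₀ : Function.update w 0 (w 0 + w i.succ) = Fin.cons (v + b i) b := by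
      simp [hwdef]
    rw [e₀] at hw₀
    have hw₁ := hw₀.update_neg i.succ
    rw [Fin.cons_succ, ← Fin.cons_update] at hw₁
    have h' : IsCompletion M e (Function.update b i (-b i)) (v + b i) d
        (Function.update a i (d - a i)) := by
      refine ⟨hw₁, ?_, ?_, ?_, h.pos⟩
      · intro l
        rcases eq_or_ne l i with rfl | hl
        · simpa using (h.lt l).le
        · simpa [hl] using h.nonneg l
      · intro l
        rcases eq_or_ne l i with rfl | hl
        · simpa using hpos
        · simpa [hl] using h.lt l
      · rw [sum_update_neg, Function.update_self, Function.update_idem, sum_update_coeff, smul_add]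
        conv_lhs => rw [h.eq]
        have : -((d : ℤ) - a i) - a i = -d := by ring
        rw [this, neg_smul]
        abel
    rw [h'.completionValue_eq, Fin.cons_update]
    have e₁ := isSymb_sym.neg _ i.succ hw₀
    rw [Fin.cons_succ] at e₁
    rw [e₁]
    have e₂ := isSymb_sym.add w 0 i.succ hne hw
    rw [e₀] at e₂
    -- In the tuple with entries v and v + b_i, the vector `e` has coordinates d - a_i and a_i at
    -- these positions; both are less than `d` because 0 < a_i < d.
    rw [e₂, map_add, hg (Function.update w i.succ (w 0 + w i.succ)) (hw.update_add hne)
      (Function.update (Fin.cons (d : ℤ) a : Fin (k + 1) → ℤ) 0 (d - a i)), zero_add]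
    · rw [sum_update_add _ _ hne, Function.update_idem]
      conv_lhs => rw [h.eq_cons]
      refine Finset.sum_congr rfl (fun l _ => ?_)
      congr 1
      refine Fin.cases ?_ (fun l => ?_) l
      · simp
      · simp
    · intro l
      refine Fin.cases ?_ (fun l => ?_) l
      · have := h.lt i
        simp only [Function.update_self]
        rw [abs_lt]
        constructor <;> omega
      · have h1 := h.lt l
        have h2 := h.nonneg l
        simp only [Function.update_of_ne (Fin.succ_ne_zero l), Fin.cons_succ]
        rw [abs_lt]
        constructor <;> omega

theorem cons_comp_perm {α : Type*} (v : α) (b : Fin k → α) (σ : Equiv.Perm (Fin k)) :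
    (Fin.cons v (b ∘ σ) : Fin (k + 1) → α) =
      (Fin.cons v b : Fin (k + 1) → α) ∘ Equiv.Perm.decomposeFin.symm (0, σ) := by
  funext l
  refine Fin.cases ?_ (fun l => ?_) l <;> simp

/-- For the three-term relation with a_j ≤ a_i, the same `v` completes all three tuples once a sign
is changed in the last: a_i b_i + a_j b_j equals (a_i - a_j) b_i + a_j (b_i + b_j) and also a_i (b_i
+ b_j) + (a_i - a_j)(-b_j). The relation is then that of the completed tuple. -/
theorem isSymb_completionValue (hM : IsLatticeIn M) (he : e ∈ M)
    (hg : ∀ w, IsPrimitive M w → ∀ a : Fin (k + 1) → ℤ, e = ∑ i, a i • w i →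
      (∀ i, |a i| < d) → g (sym M w) = 0) :
    IsSymb M (completionValue g d e : (Fin k → W) → B) where
  degenerate b hb := if_neg (fun h => hb h.1)
  neg b i hb := completionValue_neg hM he hg b i hb
  perm b σ hb := by
    by_cases hP : IsPrimitive M b ∧ e ∉ sp b ∧ index M e (sp b) = d
    swap
    · have hP' : ¬ (IsPrimitive M (b ∘ σ) ∧ e ∉ sp (b ∘ σ) ∧ index M e (sp (b ∘ σ)) = d) := by
        rw [sp_comp_perm]
        exact fun h => hP ⟨hb, h.2⟩
      rw [completionValue, completionValue, if_neg hP, if_neg hP', smul_zero]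
    obtain ⟨v, a, h⟩ := exists_isCompletion hM he hP
    have h' : IsCompletion M e (b ∘ σ) v d (a ∘ σ) := by
      refine ⟨?_, fun i => h.nonneg _, fun i => h.lt _, ?_, h.pos⟩
      · rw [cons_comp_perm]
        exact h.primitive.comp_perm _
      · conv_lhs => rw [h.eq]
        rw [← Equiv.sum_comp σ]
        rfl
    rw [h.completionValue_eq, h'.completionValue_eq, cons_comp_perm,
      isSymb_sym.perm _ _ h.primitive, map_zsmul, Equiv.Perm.decomposeFin.symm_sign]
    simp
  add b i j hij hb := by
    by_cases hP : IsPrimitive M b ∧ e ∉ sp b ∧ index M e (sp b) = d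
    swap
    · rw [completionValue, completionValue, completionValue, if_neg hP, if_neg, if_neg, add_zero]
      · rw [sp_update_add' b hij]
        exact fun h => hP ⟨hb, h.2⟩
      · rw [sp_update_add b hij]
        exact fun h => hP ⟨hb, h.2⟩
    obtain ⟨v, a, h⟩ := exists_isCompletion hM he hP
    have key : ∀ i j, i ≠ j → a j ≤ a i → completionValue g d e b =
        completionValue g d e (Function.update b j (b i + b j)) +
          completionValue g d e (Function.update b i (b i + b j)) := by
      intro i j hij hle
      have hsucc : i.succ ≠ j.succ := fun h => hij (Fin.succ_injective _ h)
      have hw := h.primitive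
      have hi0 := h.nonneg i
      have hj0 := h.nonneg j
      have hid := h.lt i
      have hjd := h.lt j
      have hw₁ := hw.update_add hsucc
      have hw₂ := hw.update_add' hsucc
      have e₁ := isSymb_sym.add _ _ _ hsucc hw
      simp only [Fin.cons_succ, ← Fin.cons_update] at hw₁ hw₂ e₁
      have h₁ : IsCompletion M e (Function.update b j (b i + b j)) v d
          (Function.update a i (a i - a j)) := by
        refine ⟨hw₁, ?_, ?_, ?_, h.pos⟩
        · intro l
          rcases eq_or_ne l i with rfl | hl
          · simpa using hle
          · simpa [hl] using h.nonneg l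
        · intro l
          rcases eq_or_ne l i with rfl | hl
          · simp only [Function.update_self]; omega
          · simpa [hl] using h.lt l
        · conv_lhs => rw [h.eq]
          rw [sum_update_add _ _ hij, Function.update_self, Function.update_of_ne hij.symm,
            Function.update_idem, sub_add_cancel, Function.update_eq_self]
      have hb₂ := hb.update_add' hij
      have hw₃ := hw₂.update_neg j.succ
      have e₃ := isSymb_sym.neg _ j.succ hw₂
      simp only [Fin.cons_succ, ← Fin.cons_update] at hw₃ e₃
      have h₂ : IsCompletion M e (Function.update (Function.update b i (b i + b j)) j
          (-(Function.update b i (b i + b j)) j)) v d (Function.update a j (a i - a j)) := by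
        refine ⟨hw₃, ?_, ?_, ?_, h.pos⟩
        · intro l
          rcases eq_or_ne l j with rfl | hl
          · simpa using hle
          · simpa [hl] using h.nonneg l
        · intro l
          rcases eq_or_ne l j with rfl | hl
          · simp only [Function.update_self]; omega
          · simpa [hl] using h.lt l
        · conv_lhs => rw [h.eq]
          rw [sum_update_neg, add_comm (b i), sum_update_add _ _ hij.symm, Function.update_idem,
            Function.update_self, Function.update_of_ne hij, Function.update_of_ne hij,
            Function.update_idem, Function.update_self]
          have : -(a i - a j) + a i = a j := by ring
          rw [this, Function.update_eq_self]
      rw [← completionValue_neg hM he hg _ j hb₂, h.completionValue_eq, h₁.completionValue_eq,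
        h₂.completionValue_eq, e₁, map_add, e₃]
    rcases le_total (a j) (a i) with hle | hle
    · exact key i j hij hle
    · rw [key j i hij.symm hle, add_comm (b j), add_comm]

end Completion

/-- Left inverses of the residue at `e`, on tuples in which `e` has coordinates of size at most
`D`. -/
theorem exists_leftInverse_residueAt (hM : IsLatticeIn M) {e : W} (he : e ∈ M) (he0 : e ≠ 0)
    (D : ℕ) :
    ∃ s : Symb M k →+ Symb M (k + 1), ∀ w, IsPrimitive M w → ∀ a : Fin (k + 1) → ℤ,
      e = ∑ i, a i • w i → (∀ i, |a i| ≤ D) → s (residueAt M k e (sym M w)) = sym M w := by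
  classical
  induction D with
  | zero =>
    refine ⟨0, fun w hw a ha h => absurd ?_ he0⟩
    rw [ha]
    refine Finset.sum_eq_zero (fun i _ => ?_)
    have : a i = 0 := abs_nonpos_iff.mp (by simpa using h i)
    rw [this, zero_smul]
  | succ D ih =>
    obtain ⟨s, hs⟩ := ih
    -- The defect of `s` as a left inverse. It vanishes where all coordinates are at most `D`, which
    -- is the hypothesis needed to extend it over tuples of index `D + 1`.
    set g : Symb M (k + 1) →+ Symb M (k + 1) :=
      AddMonoidHom.id _ - s.comp (residueAt M k e) with hgdef
    have hg : ∀ w, IsPrimitive M w → ∀ a : Fin (k + 1) → ℤ, e = ∑ i, a i • w i →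
        (∀ i, |a i| < (D + 1 : ℕ)) → g (sym M w) = 0 := by
      intro w hw a ha h
      have := hs w hw a ha (fun i => by have := h i; omega)
      simp [hgdef, this]
    set h : Symb M k →+ Symb M (k + 1) :=
      Symb.lift _ (isSymb_completionValue hM he hg) with hh
    have key : ∀ (N : ℕ) (w : Fin (k + 1) → W), IsPrimitive M w → ∀ a : Fin (k + 1) → ℤ,
        e = ∑ i, a i • w i → (∀ i, 0 ≤ a i) → (∀ i, a i ≤ (D + 1 : ℕ)) →
        (Finset.univ.filter (fun i => a i = (D + 1 : ℕ))).card = N →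
        h (residueAt M k e (sym M w)) = g (sym M w) := by
      -- `N` counts the coordinates that attain the bound `D + 1`.
      intro N
      induction N using Nat.strong_induction_on with
      | _ N ihN =>
        intro w hw a ha hnn hle hN
        by_cases h2 : ∃ i j, i ≠ j ∧ a i = (D + 1 : ℕ) ∧ a j = (D + 1 : ℕ)
        · obtain ⟨i, j, hij, hi, hj⟩ := h2
          have aux : ∀ i j, i ≠ j → a i = (D + 1 : ℕ) → a j = (D + 1 : ℕ) →
              h (residueAt M k e (sym M (Function.update w j (w i + w j)))) =
                g (sym M (Function.update w j (w i + w j))) := by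
            intro i j hij hi hj
            -- With two equal maximal coordinates, (D + 1)(w_i + w_j) needs only one of the new
            -- entries: the other coordinate becomes 0 and the count drops.
            refine ihN _ ?_ _ (hw.update_add hij) (Function.update a i 0) ?_ ?_ ?_ rfl
            · rw [← hN]
              apply Finset.card_lt_card
              rw [Finset.ssubset_iff_of_subset]
              · refine ⟨i, by simpa using hi, ?_⟩
                simp only [Finset.mem_filter, Finset.mem_univ, true_and, Function.update_self]
                omega
              · intro l
                simp only [Finset.mem_filter, Finset.mem_univ, true_and]
                rcases eq_or_ne l i with rfl | hl
                · exact fun _ => hi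
                · simp [hl]
            · rw [sum_update_add _ _ hij, Function.update_self, Function.update_of_ne hij.symm,
                Function.update_idem, zero_add, hj, ← hi, Function.update_eq_self]
              exact ha
            · intro l
              rcases eq_or_ne l i with rfl | hl
              · simp
              · simpa [hl] using hnn l
            · intro l
              rcases eq_or_ne l i with rfl | hl
              · simp only [Function.update_self]; omega
              · simpa only [Function.update_of_ne hl] using hle l
          have h1 := aux i j hij hi hj
          have h2 := aux j i hij.symm hj hi
          rw [add_comm (w j)] at h2
          rw [isSymb_sym.add w i j hij hw]
          simp only [map_add, h1, h2]
        · -- at most one coordinate attains the bound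
          -- `h` sees only faces of index `D + 1`, that is, faces opposite to a maximal coordinate.
          have hface : ∀ i, a i ≠ (D + 1 : ℕ) →
              h (if e ∉ sp (i.removeNth w) then sym M (i.removeNth w) else 0) = 0 := by
            intro i hi
            by_cases hei : e ∈ sp (i.removeNth w)
            · simp [hei]
            · rw [if_pos hei, hh, Symb.lift_sym, completionValue, if_neg]
              rintro ⟨-, -, hidx⟩
              have hai := hei
              rw [ha, sum_mem_sp_removeNth_iff hw.linearIndependent] at hai
              have := index_removeNth hw i hai
              rw [← ha, hidx] at this
              have := hnn i
              omega
          rw [residueAt_sym hw, map_sum]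
          simp only [map_zsmul]
          by_cases h1 : ∃ i, a i = (D + 1 : ℕ)
          · obtain ⟨i, hi⟩ := h1
            have hother : ∀ j, j ≠ i → a j ≠ (D + 1 : ℕ) := fun j hj hj' =>
              h2 ⟨j, i, hj, hj', hi⟩
            rw [Finset.sum_eq_single i (fun j _ hj => by rw [hface j (hother j hj), smul_zero])
              (by simp)]
            have hcons : (Fin.cons (w i) (i.removeNth w) : Fin (k + 1) → W) =
                w ∘ i.cycleRange.symm := Fin.cons_removeNth_eq_comp_cycleRange_symm w i
            -- The other coordinates being strictly smaller, `w i` is already the normalized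
            -- completion of its opposite face. Moving it to the front costs the sign (-1)^i, which
            -- cancels the sign of the residue.
            have hc : IsCompletion M e (i.removeNth w) (w i) (D + 1 : ℕ) (i.removeNth a) := by
              refine ⟨?_, fun l => hnn _, fun l => ?_, ?_, by omega⟩
              · rw [hcons]; exact hw.comp_perm _
              · exact lt_of_le_of_ne (hle _) (hother _ (Fin.succAbove_ne i l))
              · rw [← hi]
                conv_lhs => rw [ha, Fin.sum_univ_succAbove _ i]
                rfl
            rw [if_pos hc.notMem, hh, Symb.lift_sym, hc.completionValue_eq, hcons,
              isSymb_sym.perm _ _ hw, Equiv.Perm.sign_symm, Fin.sign_cycleRange, map_zsmul,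
              smul_smul]
            have : (-1 : ℤ) ^ (i : ℕ) * (((-1 : ℤˣ) ^ (i : ℕ) : ℤˣ) : ℤ) = 1 := by
              push_cast
              rw [← mul_pow]; simp
            rw [this, one_smul]
          · have hne : ∀ i, a i ≠ (D + 1 : ℕ) := fun i hi => h1 ⟨i, hi⟩
            rw [hg w hw a ha (fun i => by
              rw [abs_of_nonneg (hnn i)]; exact lt_of_le_of_ne (hle i) (hne i))]
            exact Finset.sum_eq_zero (fun i _ => by rw [hface i (hne i), smul_zero])
    -- On the tuples in question `h` composed with the residue is `g`, the defect of `s`; adding it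
    -- repairs `s`.
    refine ⟨s + h, fun w hw a ha hle => ?_⟩
    -- reduce to nonnegative coordinates by changing signs
    set ε : Fin (k + 1) → ℤˣ := fun i => if 0 ≤ a i then 1 else -1 with hε
    obtain ⟨hw', hsym⟩ := sym_smul_units w hw ε
    have hk := key _ (fun i => (ε i : ℤ) • w i) hw' (fun i => |a i|) ?_ (fun i => abs_nonneg _)
      (fun i => hle i) rfl
    · rw [hsym] at hk
      rw [AddMonoidHom.add_apply, hk, hgdef]
      simp
    · rw [ha]
      refine Finset.sum_congr rfl (fun i _ => ?_)
      rw [smul_smul]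
      congr 1
      by_cases hi : 0 ≤ a i
      · simp [hε, hi, abs_of_nonneg hi]
      · simp [hε, hi, abs_of_neg (not_le.mp hi)]

/-- The residue at `e` is injective on symbols on subspaces containing `e`. -/
theorem eq_zero_of_residueAt_eq_zero (hM : IsLatticeIn M) {e : W} (he : e ∈ M) (he0 : e ≠ 0)
    (x : Symb M (k + 1)) (hx : residueAt M k e (Symb.proj M (k + 1) (e ∈ ·) x) = 0) :
    Symb.proj M (k + 1) (e ∈ ·) x = 0 := by
  classical
  -- Only finitely many tuples occur in `x`, so one bound suffices. The left inverse is quantified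
  -- inside, since it can be chosen only once the bound is known.
  have key : ∃ D : ℕ, ∀ D', D ≤ D' → ∀ s : Symb M k →+ Symb M (k + 1),
      (∀ w, IsPrimitive M w → ∀ a : Fin (k + 1) → ℤ, e = ∑ i, a i • w i → (∀ i, |a i| ≤ D') →
        s (residueAt M k e (sym M w)) = sym M w) →
      s (residueAt M k e (Symb.proj M (k + 1) (e ∈ ·) x)) = Symb.proj M (k + 1) (e ∈ ·) x := by
    clear hx
    induction x using Symb.induction with
    | zero => exact ⟨0, fun _ _ s _ => by simp⟩
    | add x y hx hy =>
      obtain ⟨D, hD⟩ := hx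
      obtain ⟨E, hE⟩ := hy
      refine ⟨max D E, fun D' hD' s hs => ?_⟩
      simp only [map_add]
      rw [hD D' (le_trans (le_max_left _ _) hD') s hs, hE D' (le_trans (le_max_right _ _) hD') s hs]
    | neg x hx =>
      obtain ⟨D, hD⟩ := hx
      refine ⟨D, fun D' hD' s hs => ?_⟩
      simp only [map_neg]
      rw [hD D' hD' s hs]
    | sym w hw =>
      rw [Symb.proj_sym]
      by_cases hew : e ∈ sp w
      · obtain ⟨a, ha⟩ := hw.exists_eq_sum he hew
        refine ⟨∑ i, (a i).natAbs, fun D' hD' s hs => ?_⟩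
        rw [if_pos hew]
        refine hs w hw a ha (fun i => ?_)
        have : (a i).natAbs ≤ ∑ i, (a i).natAbs :=
          Finset.single_le_sum (f := fun i => (a i).natAbs) (fun _ _ => Nat.zero_le _) (Finset.mem_univ i)
        rw [Int.abs_eq_natAbs]
        omega
      · exact ⟨0, fun _ _ s _ => by simp [hew]⟩
  obtain ⟨D, hD⟩ := key
  obtain ⟨s, hs⟩ := exists_leftInverse_residueAt (k := k) hM he he0 D
  rw [← hD D le_rfl s hs, hx, map_zero]

end ResidueAt

/-! ### Chains of full flags -/

section FlagChains

variable {W : Type*} [AddCommGroup W] [Module ℚ W]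

/-- Integral chains on sequences of `k` subspaces. -/
abbrev FlagChains (W : Type*) [AddCommGroup W] [Module ℚ W] (k : ℕ) : Type _ :=
  (Fin k → Submodule ℚ W) →₀ ℤ

/-- The largest member of a flag (the zero space for the empty flag). -/
def flagTop : {k : ℕ} → (Fin k → Submodule ℚ W) → Submodule ℚ W
  | 0, _ => ⊥
  | k + 1, f => f (Fin.last k)

/-- Adding a subspace at the top of a flag. -/
def flagSnoc {k : ℕ} (U : Submodule ℚ W) (f : Fin k → Submodule ℚ W) :
    Fin (k + 1) → Submodule ℚ W :=
  Fin.snoc (α := fun _ => Submodule ℚ W) f U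

/-- Removing the top of a flag. -/
def flagInit {k : ℕ} (f : Fin (k + 1) → Submodule ℚ W) : Fin k → Submodule ℚ W :=
  fun i => f i.castSucc

@[simp]
theorem flagInit_flagSnoc {k : ℕ} (U : Submodule ℚ W) (f : Fin k → Submodule ℚ W) :
    flagInit (flagSnoc U f) = f := by
  funext i
  simp [flagInit, flagSnoc]

@[simp]
theorem flagTop_flagSnoc {k : ℕ} (U : Submodule ℚ W) (f : Fin k → Submodule ℚ W) :
    flagTop (flagSnoc U f) = U := by
  simp [flagTop, flagSnoc]

/-- Complete flags in a subspace: the `i`-th member has dimension `i + 1`. -/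
structure IsFullFlag {k : ℕ} (f : Fin k → Submodule ℚ W) : Prop where
  mono : Monotone f
  finrank : ∀ i, Module.finrank ℚ (f i) = (i : ℕ) + 1

theorem IsFullFlag.flagInit {k : ℕ} {f : Fin (k + 1) → Submodule ℚ W} (hf : IsFullFlag f) :
    IsFullFlag (flagInit f) where
  mono _ _ h := hf.mono (Fin.castSucc_le_castSucc_iff.mpr h)
  finrank i := hf.finrank i.castSucc

theorem IsFullFlag.le_flagTop {k : ℕ} {f : Fin k → Submodule ℚ W} (hf : IsFullFlag f) (i : Fin k) :
    f i ≤ flagTop f := by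
  cases k with
  | zero => exact i.elim0
  | succ k => exact hf.mono (Fin.le_last i)

theorem IsFullFlag.flagSnoc {k : ℕ} {f : Fin k → Submodule ℚ W} (hf : IsFullFlag f)
    {U : Submodule ℚ W} (hU : flagTop f ≤ U) (hr : Module.finrank ℚ U = k + 1) :
    IsFullFlag (flagSnoc U f) where
  mono := by
    intro i j hij
    induction j using Fin.lastCases with
    | last =>
      induction i using Fin.lastCases with
      | last => exact le_rfl
      | cast i => simpa [TitsSteinberg.flagSnoc] using (hf.le_flagTop i).trans hU
    | cast j =>
      induction i using Fin.lastCases with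
      | last => exact absurd hij (not_le.mpr (Fin.castSucc_lt_last j))
      | cast i => simpa [TitsSteinberg.flagSnoc] using hf.mono (Fin.castSucc_le_castSucc_iff.mp hij)
  finrank i := by
    induction i using Fin.lastCases with
    | last =>
      rw [show TitsSteinberg.flagSnoc U f (Fin.last k) = U by simp [TitsSteinberg.flagSnoc]]
      exact hr
    | cast i =>
      rw [show TitsSteinberg.flagSnoc U f i.castSucc = f i by simp [TitsSteinberg.flagSnoc]]
      exact hf.finrank i

theorem mapDomain_filter_comm {α β : Type*} (g : α → β) (p : α → Prop) (q : β → Prop)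
    [DecidablePred p] [DecidablePred q] (h : ∀ x, q (g x) ↔ p x) (c : α →₀ ℤ) :
    (c.mapDomain g).filter q = (c.filter p).mapDomain g := by
  induction c using Finsupp.induction_linear with
  | zero => simp [Finsupp.filter_zero]
  | add c c' hc hc' => rw [Finsupp.mapDomain_add, Finsupp.filter_add, hc, hc', Finsupp.filter_add,
      Finsupp.mapDomain_add]
  | single x n =>
    rw [Finsupp.mapDomain_single]
    by_cases hx : p x
    · rw [Finsupp.filter_single_of_pos _ hx, Finsupp.filter_single_of_pos _ ((h x).mpr hx),
        Finsupp.mapDomain_single]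
    · rw [Finsupp.filter_single_of_neg _ hx,
        Finsupp.filter_single_of_neg _ (fun h' => hx ((h x).mp h')), Finsupp.mapDomain_zero]

/-- Cycles: chains of full flags whose boundary vanishes, except for the faces in which the top of
the flag is omitted. -/
structure IsFlagCycle {k : ℕ} (c : FlagChains W k) : Prop where
  isFullFlag : ∀ f ∈ c.support, IsFullFlag f
  mapDomain_eq_zero : ∀ j : Fin k, (j : ℕ) + 1 < k →
    c.mapDomain (fun f => Function.update f j ⊥) = 0

theorem IsFlagCycle.sub {k : ℕ} {c c' : FlagChains W k} (h : IsFlagCycle c) (h' : IsFlagCycle c') :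
    IsFlagCycle (c - c') where
  isFullFlag f hf := by
    classical
    rcases Finset.mem_union.mp (Finsupp.support_sub hf) with hf | hf
    · exact h.isFullFlag f hf
    · exact h'.isFullFlag f hf
  mapDomain_eq_zero j hj := by
    have := (Finsupp.mapDomain.addMonoidHom (M := ℤ)
      (fun f : Fin k → Submodule ℚ W => Function.update f j ⊥)).map_sub c c'
    simp only [Finsupp.mapDomain.addMonoidHom_apply] at this
    rw [this, h.mapDomain_eq_zero j hj, h'.mapDomain_eq_zero j hj, sub_zero]

/-- Omission of a member is encoded as replacement by ⊥, so the length is kept. Below the last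
position it leaves the top alone. -/
theorem flagTop_update {k : ℕ} (f : Fin k → Submodule ℚ W) (j : Fin k) (hj : (j : ℕ) + 1 < k)
    (V : Submodule ℚ W) : flagTop (Function.update f j V) = flagTop f := by
  cases k with
  | zero => exact j.elim0
  | succ k =>
    refine Function.update_of_ne ?_ _ _
    intro h
    have := congrArg Fin.val h
    simp only [Fin.val_last] at this
    omega

-- The cycle conditions never omit the top, so they hold separately for the flags with each given
-- top. This matches the splitting of `Symb` over subspaces.
open Classical in
theorem IsFlagCycle.filter {k : ℕ} {c : FlagChains W k} (h : IsFlagCycle c)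
    (X : Submodule ℚ W → Prop) : IsFlagCycle (c.filter (fun f => X (flagTop f))) where
  isFullFlag f hf := by
    rw [Finsupp.support_filter, Finset.mem_filter] at hf
    exact h.isFullFlag f hf.1
  mapDomain_eq_zero j hj := by
    rw [← mapDomain_filter_comm _ _ (fun f => X (flagTop f)), h.mapDomain_eq_zero j hj,
      Finsupp.filter_zero]
    intro f
    rw [flagTop_update f j hj]

theorem IsFlagCycle.mapDomain_flagInit {k : ℕ} {c : FlagChains W (k + 1)} (h : IsFlagCycle c) :
    IsFlagCycle (c.mapDomain flagInit) where
  isFullFlag f hf := by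
    classical
    obtain ⟨f', hf', rfl⟩ := Finset.mem_image.mp (Finsupp.mapDomain_support hf)
    exact (h.isFullFlag f' hf').flagInit
  mapDomain_eq_zero j hj := by
    rw [← Finsupp.mapDomain_comp]
    have : (fun f => Function.update f j ⊥) ∘ (flagInit : _ → Fin k → Submodule ℚ W) =
        flagInit ∘ fun f => Function.update f j.castSucc ⊥ := by
      funext f i
      simp only [Function.comp_apply, flagInit, Function.update_apply, Fin.castSucc_inj]
    rw [this, Finsupp.mapDomain_comp, h.mapDomain_eq_zero j.castSucc (by simp),
      Finsupp.mapDomain_zero]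

/-- In two full flags that agree below `m`, where they do not contain `e`, the `m`-th members
agree if both contain `e`. -/
theorem IsFullFlag.apply_eq [FiniteDimensional ℚ W] {k : ℕ} {f f' : Fin k → Submodule ℚ W}
    (hf : IsFullFlag f) (hf' : IsFullFlag f') {e : W} (he0 : e ≠ 0) (m : Fin k)
    (hlt : ∀ i, i < m → f i = f' i) (he : ∀ i, i < m → e ∉ f i) (hm : e ∈ f m) (hm' : e ∈ f' m) :
    f m = f' m := by
  -- `V` is the common previous member, or ⊥ when `m = 0`. For reasons of dimension, both `m`-th
  -- members equal `V` plus the line of `e`.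
  obtain ⟨V, hV, hV', heV, hr⟩ : ∃ V : Submodule ℚ W, V ≤ f m ∧ V ≤ f' m ∧ e ∉ V ∧
      Module.finrank ℚ V = m := by
    rcases Nat.eq_zero_or_pos (m : ℕ) with h0 | hpos
    · exact ⟨⊥, bot_le, bot_le, by simpa using he0, by simp [h0]⟩
    · let i : Fin k := ⟨m - 1, by omega⟩
      have hi : i < m := Fin.lt_def.mpr (by simp only [i]; omega)
      refine ⟨f i, hf.mono hi.le, ?_, he i hi, ?_⟩
      · rw [hlt i hi]; exact hf'.mono hi.le
      · rw [hf.finrank]; simp only [i]; omega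
  have hlt' : V < V ⊔ Submodule.span ℚ {e} := by
    refine lt_of_le_of_ne le_sup_left (fun h => heV ?_)
    rw [h]
    exact (le_sup_right : _ ≤ V ⊔ Submodule.span ℚ {e}) (Submodule.mem_span_singleton_self e)
  have hle : V ⊔ Submodule.span ℚ {e} ≤ f m :=
    sup_le hV ((Submodule.span_singleton_le_iff_mem _ _).mpr hm)
  have hle' : V ⊔ Submodule.span ℚ {e} ≤ f' m :=
    sup_le hV' ((Submodule.span_singleton_le_iff_mem _ _).mpr hm')
  have h1 := Submodule.finrank_lt_finrank_of_lt hlt'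
  have h2 := Submodule.finrank_mono hle
  have h3 := Submodule.finrank_mono hle'
  rw [hf.finrank] at h2
  rw [hf'.finrank] at h3
  have e1 : V ⊔ Submodule.span ℚ {e} = f m :=
    Submodule.eq_of_le_of_finrank_eq hle (by rw [hf.finrank]; omega)
  have e2 : V ⊔ Submodule.span ℚ {e} = f' m :=
    Submodule.eq_of_le_of_finrank_eq hle' (by rw [hf'.finrank]; omega)
  exact e1.symm.trans e2

theorem mapDomain_apply_eq_of_forall {α β : Type*} (g : α → β) (c : α →₀ ℤ) (x : α)
    (h : ∀ y, y ≠ x → g y = g x → c y = 0) : c.mapDomain g (g x) = c x := by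
  classical
  rw [Finsupp.mapDomain, Finsupp.sum_apply, Finsupp.sum, Finset.sum_eq_single x]
  · simp
  · intro y _ hy
    by_cases hg : g y = g x
    · simp [h y hy hg]
    · simp [hg]
  · intro hx
    simp [Finsupp.notMem_support_iff.mp hx]

/-- A cycle supported on flags whose top contains `e` is determined by the flags whose second
largest member avoids `e`. -/
theorem IsFlagCycle.eq_zero [FiniteDimensional ℚ W] {k : ℕ} {c : FlagChains W (k + 1)}
    (hc : IsFlagCycle c) {e : W} (he0 : e ≠ 0) (hsupp : ∀ f ∈ c.support, e ∈ flagTop f)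
    (hres : ∀ f, e ∉ flagTop f → c.mapDomain flagInit f = 0) : c = 0 := by
  -- Downward induction on the number `m` of initial members known to avoid `e`. At `m = k + 1` the
  -- top avoids `e`, contrary to the support; at `m = 0` nothing is assumed.
  have key : ∀ d m : ℕ, m + d = k + 1 → ∀ f, (∀ i : Fin (k + 1), (i : ℕ) < m → e ∉ f i) →
      c f = 0 := by
    intro d
    induction d with
    | zero =>
      intro m hm f hf
      by_contra hne
      exact hf (Fin.last k) (by simp; omega) (hsupp f (Finsupp.mem_support_iff.mpr hne))
    | succ d ih =>
      intro m hm f hf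
      by_contra hne
      have hfull := hc.isFullFlag f (Finsupp.mem_support_iff.mpr hne)
      set μ : Fin (k + 1) := ⟨m, by omega⟩ with hμ
      by_cases hem : e ∈ f μ
      swap
      · refine hne (ih (m + 1) (by omega) f (fun i hi => ?_))
        rcases Nat.lt_succ_iff_lt_or_eq.mp hi with h | h
        · exact hf i h
        · have : i = μ := Fin.ext h
          rwa [this]
      -- flags that agree with `f` except in position `m` avoid `e` up to position `m`
      have hother : ∀ f', f' ≠ f → (∀ i, i ≠ μ → f' i = f i) → c f' = 0 := by
        intro f' hff' hag
        by_contra hne'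
        have hfull' := hc.isFullFlag f' (Finsupp.mem_support_iff.mpr hne')
        have hem' : e ∉ f' μ := by
          intro hem'
          have := hfull.apply_eq hfull' he0 μ (fun i hi => (hag i hi.ne).symm)
            (fun i hi => hf i hi) hem hem'
          apply hff'
          funext i
          rcases eq_or_ne i μ with rfl | hi
          · exact this.symm
          · exact hag i hi
        refine hne' (ih (m + 1) (by omega) f' (fun i hi => ?_))
        rcases eq_or_ne i μ with rfl | hiμ
        · exact hem'
        · rw [hag i hiμ]
          refine hf i ?_
          have : (i : ℕ) ≠ m := fun h => hiμ (Fin.ext h)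
          omega
      -- By `hother`, only `f` contributes to its own face omitting position `m`. That face has
      -- coefficient zero by the cycle condition below the top, and by `hres` at the top.
      rcases Nat.lt_or_ge (m + 1) (k + 1) with hlt | hge
      · have h0 := hc.mapDomain_eq_zero μ hlt
        have h1 := mapDomain_apply_eq_of_forall (fun f => Function.update f μ ⊥) c f ?_
        · rw [h0] at h1
          exact hne h1.symm
        · intro f' hff' hup
          refine hother f' hff' (fun i hi => ?_)
          have := congrFun hup i
          simpa [Function.update_of_ne hi] using this
      · have hμl : μ = Fin.last k := Fin.ext (by simp [hμ]; omega)
        have h1 := mapDomain_apply_eq_of_forall flagInit c f ?_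
        · rw [hres] at h1
          · exact hne h1.symm
          · cases k with
            | zero => simpa [flagTop] using he0
            | succ k =>
              refine hf (Fin.last k).castSucc ?_
              simp
              omega
        · intro f' hff' hup
          refine hother f' hff' (fun i hi => ?_)
          rw [hμl] at hi
          obtain ⟨i, rfl⟩ := Fin.exists_castSucc_eq.mpr hi
          exact congrFun hup i
  ext f
  exact key (k + 1) 0 (by omega) f (fun i hi => absurd hi (Nat.not_lt_zero _))

end FlagChains

/-! ### The apartment map -/

section Apartment

variable {W : Type*} [AddCommGroup W] [Module ℚ W]

/-- Appending the span of the tuple as new top is an operation that depends on the span alone, which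
the relations preserve. This makes the recursion for `apartmentMap` well defined. -/
theorem isSymb_span_dependent {M : AddSubgroup W} {k : ℕ} {A B : Type*} [AddCommGroup A]
    [AddCommGroup B] (F : Symb M k →+ A) (T : Submodule ℚ W → A →+ B) :
    IsSymb M (fun w => T (sp w) (F (sym M w))) where
  degenerate w hw := by simp [isSymb_sym.degenerate w hw]
  add w i j hij hw := by
    rw [sp_update_add w hij, sp_update_add' w hij, isSymb_sym.add w i j hij hw, map_add, map_add]
  neg w i hw := by rw [sp_update_neg, isSymb_sym.neg w i hw]
  perm w σ hw := by rw [sp_comp_perm, isSymb_sym.perm w σ hw, map_zsmul, map_zsmul]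

theorem isSymb_const (M : AddSubgroup W) {A : Type*} [AddCommGroup A] (x : A) :
    IsSymb M (fun _ : Fin 0 → W => x) where
  degenerate b hb := absurd (isPrimitive_fin_zero b) hb
  add b i := i.elim0
  neg b i := i.elim0
  perm b σ hb := by simp [Subsingleton.elim σ 1]

/-- The apartment map, from symbols to chains of flags. -/
def apartmentMap (M : AddSubgroup W) : (k : ℕ) → Symb M k →+ FlagChains W k
  | 0 => Symb.lift _ (isSymb_const M (Finsupp.single default 1))
  | k + 1 => Symb.lift _ (isSymb_span_dependent ((apartmentMap M k).comp (residue M k))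
      (fun U => Finsupp.mapDomain.addMonoidHom (flagSnoc U)))

variable {M : AddSubgroup W}

theorem apartmentMap_zero_sym (b : Fin 0 → W) :
    apartmentMap M 0 (sym M b) = Finsupp.single default 1 := by
  simp [apartmentMap]

theorem apartmentMap_succ_sym {k : ℕ} (w : Fin (k + 1) → W) :
    apartmentMap M (k + 1) (sym M w) =
      (apartmentMap M k (residue M k (sym M w))).mapDomain (flagSnoc (sp w)) := by
  simp [apartmentMap]

/-- The residue corresponds to omitting the top of a flag. -/
theorem mapDomain_flagInit_apartmentMap {k : ℕ} (x : Symb M (k + 1)) :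
    (apartmentMap M (k + 1) x).mapDomain flagInit = apartmentMap M k (residue M k x) := by
  have : (Finsupp.mapDomain.addMonoidHom flagInit).comp (apartmentMap M (k + 1)) =
      (apartmentMap M k).comp (residue M k) := by
    refine Symb.hom_ext (fun w _ => ?_)
    simp only [AddMonoidHom.comp_apply, apartmentMap_succ_sym, Finsupp.mapDomain.addMonoidHom_apply]
    rw [← Finsupp.mapDomain_comp]
    have : flagInit ∘ flagSnoc (k := k) (sp w) = id := by funext f; simp
    rw [this, Finsupp.mapDomain_id]
  exact DFunLike.congr_fun this x

theorem apartmentMap_sym_support {k : ℕ} (w : Fin k → W) (hw : IsPrimitive M w) :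
    ∀ f ∈ (apartmentMap M k (sym M w)).support, IsFullFlag f ∧ flagTop f = sp w := by
  classical
  induction k with
  | zero =>
    intro f _
    refine ⟨⟨fun i => i.elim0, fun i => i.elim0⟩, ?_⟩
    simp [flagTop, sp, Set.range_eq_empty]
  | succ k ih =>
    intro f hf
    rw [apartmentMap_succ_sym] at hf
    obtain ⟨f, hf', rfl⟩ := Finset.mem_image.mp (Finsupp.mapDomain_support hf)
    rw [residue_sym hw, map_sum] at hf'
    obtain ⟨i, _, hi⟩ := Finset.mem_biUnion.mp (Finsupp.support_finsetSum hf')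
    rw [map_zsmul] at hi
    obtain ⟨h1, h2⟩ := ih _ (hw.removeNth i) f (Finsupp.support_smul hi)
    refine ⟨h1.flagSnoc ?_ ?_, by simp⟩
    · rw [h2]
      refine Submodule.span_mono ?_
      rintro _ ⟨l, rfl⟩
      exact ⟨_, rfl⟩
    · rw [finrank_span_eq_card hw.linearIndependent, Fintype.card_fin]

open Classical in
theorem apartmentMap_proj {k : ℕ} (X : Submodule ℚ W → Prop) (x : Symb M k) :
    apartmentMap M k (Symb.proj M k X x) =
      (apartmentMap M k x).filter (fun f => X (flagTop f)) := by
  induction x using Symb.induction with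
  | zero => simp [Finsupp.filter_zero]
  | add x y hx hy => simp only [map_add, hx, hy, Finsupp.filter_add]
  | neg x hx => simp only [map_neg, hx, Finsupp.filter_neg]
  | sym w hw =>
    have h := apartmentMap_sym_support w hw
    rw [Symb.proj_sym]
    by_cases hX : X (sp w)
    · rw [if_pos hX, eq_comm, Finsupp.filter_eq_self_iff]
      intro f hf
      rw [(h f (Finsupp.mem_support_iff.mpr hf)).2]
      exact hX
    · rw [if_neg hX, map_zero, eq_comm, Finsupp.filter_eq_zero_iff]
      intro f hf
      by_contra hne
      rw [(h f (Finsupp.mem_support_iff.mpr hne)).2] at hf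
      exact hX hf

/-- Omitting a member further down is covered by induction applied to the residue. Omitting the
member just below the top amounts to taking the residue twice, which is zero. -/
theorem isFlagCycle_apartmentMap {k : ℕ} (x : Symb M k) : IsFlagCycle (apartmentMap M k x) where
  isFullFlag := by
    classical
    induction x using Symb.induction with
    | zero => simp
    | add x y hx hy =>
      intro f hf
      rw [map_add] at hf
      rcases Finset.mem_union.mp (Finsupp.support_add hf) with hf | hf
      · exact hx f hf
      · exact hy f hf
    | neg x hx =>
      intro f hf
      rw [map_neg, Finsupp.support_neg] at hf
      exact hx f hf
    | sym w hw => exact fun f hf => (apartmentMap_sym_support w hw f hf).1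
  mapDomain_eq_zero := by
    intro j hj
    induction k with
    | zero => exact j.elim0
    | succ k ih =>
      have h : (Finsupp.mapDomain.addMonoidHom (M := ℤ)
          (fun f : Fin (k + 1) → Submodule ℚ W => Function.update f j ⊥)).comp
          (apartmentMap M (k + 1)) = 0 := by
        refine Symb.hom_ext (fun w _ => ?_)
        simp only [AddMonoidHom.comp_apply, apartmentMap_succ_sym, AddMonoidHom.zero_apply,
          Finsupp.mapDomain.addMonoidHom_apply]
        induction j using Fin.lastCases with
        | last => simp at hj
        | cast j =>
          have e1 : (fun f : Fin (k + 1) → Submodule ℚ W => Function.update f j.castSucc ⊥) ∘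
              flagSnoc (sp w) = flagSnoc (sp w) ∘ fun f => Function.update f j ⊥ := by
            funext f
            simp only [Function.comp_apply, flagSnoc, Fin.snoc_update]
          rw [← Finsupp.mapDomain_comp, e1, Finsupp.mapDomain_comp]
          rcases Nat.lt_or_ge ((j : ℕ) + 1) k with hlt | hge
          · rw [ih (residue M k (sym M w)) j hlt, Finsupp.mapDomain_zero]
          · cases k with
            | zero => exact j.elim0
            | succ k =>
              have hjl : j = Fin.last k := Fin.ext (by simp; omega)
              have e2 : (fun f : Fin (k + 1) → Submodule ℚ W => Function.update f j ⊥) =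
                  flagSnoc ⊥ ∘ flagInit := by
                funext f i
                rw [hjl]
                refine Fin.lastCases ?_ (fun i => ?_) i
                · simp [flagSnoc]
                · simp [flagSnoc, flagInit]
              rw [e2, Finsupp.mapDomain_comp, mapDomain_flagInit_apartmentMap, residue_residue,
                map_zero, Finsupp.mapDomain_zero, Finsupp.mapDomain_zero]
      exact DFunLike.congr_fun h x

theorem exists_mem_ne_zero_of_isPrimitive {k : ℕ} {w : Fin (k + 1) → W} (hw : IsPrimitive M w) :
    w 0 ∈ M ∧ w 0 ≠ 0 ∧ w 0 ∈ sp w :=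
  ⟨hw.mem 0, hw.linearIndependent.ne_zero 0, Submodule.subset_span ⟨0, rfl⟩⟩

/-- Work with one subspace U at a time and take a nonzero lattice vector `e` in it. The residue at
`e` of a kernel element is a kernel element of lower degree, hence zero, and the residue at `e` is
injective on symbols whose span contains `e`. -/
theorem apartmentMap_injective (hM : IsLatticeIn M) (k : ℕ) :
    Function.Injective (apartmentMap M k) := by
  classical
  rw [injective_iff_map_eq_zero]
  induction k with
  | zero =>
    intro x hx
    have : ∀ x : Symb M 0, ∃ n : ℤ, x = n • sym M default := by
      intro x
      induction x using Symb.induction with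
      | zero => exact ⟨0, by simp⟩
      | add x y hx hy =>
        obtain ⟨m, rfl⟩ := hx
        obtain ⟨n, rfl⟩ := hy
        exact ⟨m + n, by rw [add_smul]⟩
      | neg x hx =>
        obtain ⟨m, rfl⟩ := hx
        exact ⟨-m, by rw [neg_smul]⟩
      | sym b hb => exact ⟨1, by rw [one_smul, Subsingleton.elim b default]⟩
    obtain ⟨n, rfl⟩ := this x
    rw [map_zsmul, apartmentMap_zero_sym, Finsupp.smul_single, smul_eq_mul, mul_one,
      Finsupp.single_eq_zero] at hx
    rw [hx, zero_smul]
  | succ k ih =>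
    intro x hx
    refine Symb.eq_zero_of_proj x (fun U => ?_)
    by_cases hU : U = ⊥
    · -- primitive tuples of positive length span a nonzero space
      have : Symb.proj M (k + 1) (· = U) = 0 := by
        refine Symb.hom_ext (fun w hw => ?_)
        obtain ⟨-, h1, h2⟩ := exists_mem_ne_zero_of_isPrimitive hw
        rw [Symb.proj_sym, if_neg, AddMonoidHom.zero_apply]
        rintro h
        rw [h, hU, Submodule.mem_bot] at h2
        exact h1 h2
      rw [this, AddMonoidHom.zero_apply]
    obtain ⟨u, huU, hu0⟩ := Submodule.exists_mem_ne_zero_of_ne_bot hU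
    obtain ⟨D, hD, he⟩ := hM.exists_smul_mem u
    set e := D • u with hedef
    have he0 : e ≠ 0 := by
      rw [hedef, ← Int.cast_smul_eq_zsmul ℚ]
      exact smul_ne_zero (by exact_mod_cast hD) hu0
    have heU : e ∈ U := zsmul_mem huU D
    have hz : Symb.proj M (k + 1) (e ∈ ·) x = 0 := by
      refine eq_zero_of_residueAt_eq_zero hM he he0 x (ih _ ?_)
      rw [residueAt, AddMonoidHom.comp_apply, apartmentMap_proj, ← mapDomain_flagInit_apartmentMap,
        apartmentMap_proj, hx]
      simp [Finsupp.filter_zero]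
    have := Symb.proj_proj (· = U) (e ∈ ·) x
    rw [hz, map_zero] at this
    rw [this]
    congr 2
    funext V
    exact propext ⟨fun h => ⟨h, h ▸ heU⟩, fun h => h.1⟩

/-- For flags with top U containing `e`, the truncated cycle is the image of some `y` by induction.
Lift the part of `y` avoiding `e` to a symbol `x` on subspaces containing `e`. The image of `x` and
the cycle have the same truncation away from `e`, so they agree by `IsFlagCycle.eq_zero`. -/
theorem IsFlagCycle.exists_apartmentMap_eq [FiniteDimensional ℚ W] (hM : IsLatticeIn M) {k : ℕ} {c : FlagChains W k}
    (hc : IsFlagCycle c) : ∃ x, apartmentMap M k x = c := by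
  classical
  induction k with
  | zero =>
    refine ⟨c default • sym M default, ?_⟩
    rw [map_zsmul, apartmentMap_zero_sym, Finsupp.smul_single, smul_eq_mul, mul_one]
    refine Finsupp.ext (fun f => ?_)
    rw [Subsingleton.elim f default, Finsupp.single_eq_same]
  | succ k ih =>
    have hU : ∀ U : Submodule ℚ W, ∃ x, apartmentMap M (k + 1) x =
        c.filter (fun f => flagTop f = U) := by
      intro U
      set c' := c.filter (fun f => flagTop f = U) with hc'def
      have hc' : IsFlagCycle c' := hc.filter (· = U)
      by_cases hbot : U = ⊥
      · refine ⟨0, ?_⟩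
        rw [map_zero, eq_comm, hc'def, Finsupp.filter_eq_zero_iff]
        intro f hf
        by_contra hne
        have := (hc.isFullFlag f (Finsupp.mem_support_iff.mpr hne)).finrank (Fin.last k)
        rw [show f (Fin.last k) = ⊥ from hf.trans hbot, finrank_bot] at this
        omega
      obtain ⟨u, huU, hu0⟩ := Submodule.exists_mem_ne_zero_of_ne_bot hbot
      obtain ⟨D, hD, he⟩ := hM.exists_smul_mem u
      set e := D • u with hedef
      have he0 : e ≠ 0 := by
        rw [hedef, ← Int.cast_smul_eq_zsmul ℚ]
        exact smul_ne_zero (by exact_mod_cast hD) hu0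
      have heU : e ∈ U := zsmul_mem huU D
      obtain ⟨y, hy⟩ := ih (hc'.mapDomain_flagInit)
      obtain ⟨x, hx, hxy⟩ := exists_residueAt_eq hM he y
      refine ⟨x, ?_⟩
      rw [← sub_eq_zero]
      refine ((isFlagCycle_apartmentMap x).sub hc').eq_zero he0 ?_ ?_
      · intro f hf
        rcases Finset.mem_union.mp (Finsupp.support_sub hf) with hf | hf
        · rw [← hx, apartmentMap_proj, Finsupp.support_filter, Finset.mem_filter] at hf
          exact hf.2
        · rw [hc'def, Finsupp.support_filter, Finset.mem_filter] at hf
          rw [hf.2]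
          exact heU
      · intro f hf
        have h1 := congrArg (apartmentMap M k) hxy
        rw [residueAt, AddMonoidHom.comp_apply, apartmentMap_proj, apartmentMap_proj, hy,
          ← mapDomain_flagInit_apartmentMap] at h1
        have h2 := DFunLike.congr_fun h1 f
        rw [Finsupp.filter_apply, Finsupp.filter_apply, if_pos hf, if_pos hf] at h2
        have h3 := (Finsupp.mapDomain.addMonoidHom (M := ℤ)
          (flagInit : (Fin (k + 1) → Submodule ℚ W) → _)).map_sub (apartmentMap M (k + 1) x) c'
        simp only [Finsupp.mapDomain.addMonoidHom_apply] at h3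
        rw [h3, Finsupp.sub_apply, h2, sub_self]
    choose x hx using hU
    refine ⟨∑ U ∈ c.support.image flagTop, x U, ?_⟩
    rw [map_sum]
    ext f
    rw [Finsupp.finsetSum_apply]
    simp only [hx]
    by_cases hf : c f = 0
    · rw [hf]
      refine Finset.sum_eq_zero (fun U _ => ?_)
      rw [Finsupp.filter_apply, hf, ite_self]
    · rw [Finset.sum_eq_single (flagTop f)]
      · rw [Finsupp.filter_apply, if_pos rfl]
      · intro U _ hU
        rw [Finsupp.filter_apply, if_neg hU.symm]
      · intro h
        exact absurd (Finset.mem_image_of_mem _ (Finsupp.mem_support_iff.mpr hf)) h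

end Apartment

/-! ### The apartment map as a sum over permutations -/

section PermSum

variable {W : Type*} [AddCommGroup W] [Module ℚ W] {M : AddSubgroup W}

/-- The flag of spans of the initial segments of a tuple. -/
def spanFlag {k : ℕ} (w : Fin k → W) : Fin k → Submodule ℚ W :=
  fun i => Submodule.span ℚ (w '' {j | (j : ℕ) ≤ (i : ℕ)})

theorem spanFlag_succ {k : ℕ} (w : Fin (k + 1) → W) :
    spanFlag w = flagSnoc (sp w) (spanFlag (fun i => w i.castSucc)) := by
  funext i
  induction i using Fin.lastCases with
  | last =>
    have : {j : Fin (k + 1) | (j : ℕ) ≤ (Fin.last k : Fin (k + 1))} = Set.univ := by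
      ext j
      simpa using Nat.lt_succ_iff.mp j.2
    simp only [spanFlag, flagSnoc, Fin.snoc_last, this, Set.image_univ]
  | cast i =>
    simp only [spanFlag, flagSnoc, Fin.snoc_castSucc, Fin.val_castSucc]
    congr 1
    ext x
    constructor
    · rintro ⟨j, hj, rfl⟩
      have hj' : (j : ℕ) ≤ i := hj
      exact ⟨⟨j, by omega⟩, hj, rfl⟩
    · rintro ⟨j, hj, rfl⟩
      exact ⟨j.castSucc, hj, rfl⟩

/-- The sign relating the apartment map to the sum over permutations. -/
def apartmentSign : ℕ → ℤ
  | 0 => 1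
  | k + 1 => (-1) ^ k * apartmentSign k

theorem apartmentSign_mul_self (k : ℕ) : apartmentSign k * apartmentSign k = 1 := by
  induction k with
  | zero => simp [apartmentSign]
  | succ k ih =>
    have : ((-1 : ℤ) ^ k) * (-1) ^ k = 1 := by rw [← mul_pow]; simp
    simp only [apartmentSign]
    linear_combination ((-1 : ℤ) ^ k * (-1) ^ k) * ih + this

/-- Permutations are sorted by the image `i` of the last position, as in a Laplace expansion. `F` is
defined on all self-maps so that it can be evaluated without assembling a permutation. -/
theorem sum_perm_succ {k : ℕ} {A : Type*} [AddCommGroup A] (F : (Fin (k + 1) → Fin (k + 1)) → A) :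
    ∑ σ : Equiv.Perm (Fin (k + 1)), (Equiv.Perm.sign σ : ℤ) • F σ =
      (-1 : ℤ) ^ k • ∑ i : Fin (k + 1), (-1 : ℤ) ^ (i : ℕ) • ∑ τ : Equiv.Perm (Fin k),
        (Equiv.Perm.sign τ : ℤ) •
          F (Fin.snoc (α := fun _ => Fin (k + 1)) (fun j => i.succAbove (τ j)) i) := by
  choose τ h1 h2 using fun σ : Equiv.Perm (Fin (k + 1)) => exists_perm_succAbove σ (Fin.last k)
  simp only [Fin.succAbove_last, Fin.val_last] at h1 h2
  simp only [Finset.smul_sum]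
  rw [← Fintype.sum_prod_type' (f := fun (i : Fin (k + 1)) (τ : Equiv.Perm (Fin k)) =>
    (-1 : ℤ) ^ k • (-1 : ℤ) ^ (i : ℕ) • (Equiv.Perm.sign τ : ℤ) •
      F (Fin.snoc (α := fun _ => Fin (k + 1)) (fun j => i.succAbove (τ j)) i))]
  have hbij : Function.Bijective (fun σ : Equiv.Perm (Fin (k + 1)) => (σ (Fin.last k), τ σ)) := by
    rw [Fintype.bijective_iff_injective_and_card]
    constructor
    · intro σ σ' h
      obtain ⟨ha, hb⟩ := Prod.ext_iff.mp h
      simp only at ha hb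
      refine Equiv.ext (fun j => ?_)
      induction j using Fin.lastCases with
      | last => exact ha
      | cast j => rw [h1, h1, ha, hb]
    · simp [Fintype.card_perm, Nat.factorial_succ]
  refine Fintype.sum_bijective _ hbij _ _ (fun σ => ?_)
  have hσ : (Fin.snoc (α := fun _ => Fin (k + 1))
      (fun j => (σ (Fin.last k)).succAbove (τ σ j)) (σ (Fin.last k))) = ⇑σ := by
    funext j
    induction j using Fin.lastCases with
    | last => simp
    | cast j => simp [h1]
  rw [hσ, smul_smul, smul_smul]
  congr 1
  have e : ((-1 : ℤ) ^ ((σ (Fin.last k) : Fin (k + 1)) : ℕ)) *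
      (-1) ^ ((σ (Fin.last k) : Fin (k + 1)) : ℕ) = 1 := by
    rw [← mul_pow]; simp
  linear_combination (-(Equiv.Perm.sign σ : ℤ)) * e -
    ((-1 : ℤ) ^ ((σ (Fin.last k) : Fin (k + 1)) : ℕ)) * h2 σ

/-- The residue chooses which vector enters the flag last. Each stage contributes the sign (-1)^k of
moving it past the others, and these accumulate to `apartmentSign`. -/
theorem apartmentMap_sym_eq_sum {k : ℕ} (w : Fin k → W) (hw : IsPrimitive M w) :
    apartmentMap M k (sym M w) = apartmentSign k • ∑ σ : Equiv.Perm (Fin k),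
      (Equiv.Perm.sign σ : ℤ) • Finsupp.single (spanFlag (w ∘ σ)) (1 : ℤ) := by
  induction k with
  | zero =>
    rw [apartmentMap_zero_sym]
    simp [apartmentSign, Subsingleton.elim (spanFlag _) (default : Fin 0 → Submodule ℚ W)]
  | succ k ih =>
    rw [apartmentMap_succ_sym, residue_sym hw, map_sum]
    simp only [map_zsmul, ih _ (hw.removeNth _)]
    rw [sum_perm_succ (fun s => Finsupp.single (spanFlag (w ∘ s)) (1 : ℤ)), smul_smul, apartmentSign]
    have e : ((-1 : ℤ) ^ k) * apartmentSign k * (-1) ^ k = apartmentSign k := by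
      have : ((-1 : ℤ) ^ k) * (-1) ^ k = 1 := by rw [← mul_pow]; simp
      linear_combination apartmentSign k * this
    rw [e]
    change Finsupp.mapDomain.addMonoidHom (flagSnoc (sp w)) _ = _
    rw [map_sum, Finset.smul_sum]
    refine Finset.sum_congr rfl (fun i _ => ?_)
    rw [map_zsmul, map_zsmul, map_sum, smul_comm]
    congr 2
    refine Finset.sum_congr rfl (fun τ _ => ?_)
    rw [map_zsmul, Finsupp.mapDomain.addMonoidHom_apply, Finsupp.mapDomain_single, spanFlag_succ
      (w ∘ _)]
    congr 3
    · have hσ : Function.Surjective (Fin.snoc (α := fun _ => Fin (k + 1))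
          (fun j => i.succAbove (τ j)) i) := by
        intro j
        rcases Fin.eq_self_or_eq_succAbove i j with rfl | ⟨l, rfl⟩
        · exact ⟨Fin.last k, by simp⟩
        · exact ⟨(τ.symm l).castSucc, by simp⟩
      rw [sp, sp, hσ.range_comp]
    · congr 1
      funext j
      simp [Fin.removeNth]

end PermSum

/-! ### The standard lattice -/

section StandardLattice

/-- Vectors with integral coordinates. -/
def intVectors (n : ℕ) : AddSubgroup (Fin n → ℚ) where
  carrier := {x | ∀ i, ∃ z : ℤ, x i = z}
  zero_mem' i := ⟨0, by simp⟩
  add_mem' := by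
    intro x y hx hy i
    obtain ⟨a, ha⟩ := hx i
    obtain ⟨b, hb⟩ := hy i
    exact ⟨a + b, by simp [ha, hb]⟩
  neg_mem' := by
    intro x hx i
    obtain ⟨a, ha⟩ := hx i
    exact ⟨-a, by simp [ha]⟩

theorem exists_common_denominator {n : ℕ} (q : Fin n → ℚ) :
    ∃ D : ℤ, D ≠ 0 ∧ ∀ i, ∃ z : ℤ, D * q i = z := by
  obtain ⟨D, hD⟩ := IsLocalization.exist_integer_multiples_of_finite (nonZeroDivisors ℤ) q
  refine ⟨D, nonZeroDivisors.coe_ne_zero D, fun i => ?_⟩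
  obtain ⟨z, hz⟩ := hD i
  exact ⟨z, by simpa using hz.symm⟩

theorem isLatticeIn_intVectors (n : ℕ) : IsLatticeIn (intVectors n) where
  exists_integral φ := by
    obtain ⟨D, hD, h⟩ := exists_common_denominator (fun i => φ (Pi.single i 1))
    choose z hz using h
    refine ⟨D, hD, fun x hx => ?_⟩
    choose y hy using hx
    refine ⟨∑ i, y i * z i, ?_⟩
    conv_lhs => rw [LinearMap.pi_apply_eq_sum_univ φ x]
    push_cast
    rw [Finset.mul_sum]
    refine Finset.sum_congr rfl (fun i _ => ?_)
    have : (fun j => if i = j then (1 : ℚ) else 0) = Pi.single i 1 := by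
      funext j
      simp [Pi.single_apply, eq_comm]
    rw [this, smul_eq_mul, hy, ← hz]
    ring
  exists_smul_mem x := by
    obtain ⟨D, hD, h⟩ := exists_common_denominator x
    exact ⟨D, hD, fun i => by simpa using h i⟩

theorem IntBasis.isPrimitive_toRat {n : ℕ} (v : IntBasis n) :
    IsPrimitive (intVectors n) v.toRat where
  linearIndependent := v.toRat.linearIndependent
  mem_iff c := by
    constructor
    · intro h
      choose z hz using h
      have h1 : ∑ i, c i • v.toRat i = ∑ i, (v.repr z i : ℚ) • v.toRat i := by
        funext k
        rw [hz k]
        have := congrFun (v.sum_repr z) k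
        rw [Finset.sum_apply] at this ⊢
        rw [← this]
        push_cast
        simp [IntBasis.toRat_apply]
      intro i
      refine ⟨v.repr z i, ?_⟩
      have := congrArg (fun x => v.toRat.repr x i) h1
      simpa [Finsupp.single_apply] using this
    · intro h
      refine sum_mem (fun i _ k => ?_)
      obtain ⟨z, hz⟩ := h i
      exact ⟨z * v i k, by simp [hz, IntBasis.toRat_apply]⟩

/-- An independent n-tuple spans ℚⁿ, so for it primitivity says that every integral vector is an
integral combination. -/
theorem IsPrimitive.exists_intBasis {n : ℕ} {b : Fin n → Fin n → ℚ}
    (hb : IsPrimitive (intVectors n) b) : ∃ v : IntBasis n, ⇑v.toRat = b := by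
  choose u hu using fun i => hb.mem i
  have hcast : ∀ a : Fin n → ℤ, ∀ k, ((∑ i, a i • u i) k : ℚ) = (∑ i, a i • b i) k := by
    intro a k
    rw [Finset.sum_apply, Finset.sum_apply]
    push_cast
    simp [hu]
  have hli : LinearIndependent ℤ u := by
    rw [Fintype.linearIndependent_iff]
    intro a ha i
    have h0 : ∑ i, (a i : ℚ) • b i = 0 := by
      rw [sum_cast_smul]
      funext k
      rw [← hcast, ha]
      simp
    exact_mod_cast Fintype.linearIndependent_iff.mp hb.linearIndependent _ h0 i
  have hsp : ⊤ ≤ Submodule.span ℤ (Set.range u) := by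
    intro z _
    have hz : (fun k => (z k : ℚ)) ∈ sp b := by
      rw [Submodule.eq_top_of_finrank_eq (S := sp b)
        (by rw [finrank_span_eq_card hb.linearIndependent]; simp)]
      trivial
    obtain ⟨a, ha⟩ := hb.exists_eq_sum (x := fun k => (z k : ℚ)) (fun k => ⟨z k, rfl⟩) hz
    rw [Submodule.mem_span_range_iff_exists_fun]
    refine ⟨a, ?_⟩
    funext k
    have := congrFun ha k
    rw [← hcast] at this
    exact_mod_cast this.symm
  refine ⟨Module.Basis.mk hli hsp, ?_⟩
  funext i k
  rw [IntBasis.toRat_apply, Module.Basis.mk_apply, hu]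

theorem IntBasis.toRat_injective {n : ℕ} {v v' : IntBasis n} (h : ⇑v.toRat = ⇑v'.toRat) :
    v = v' := by
  apply Module.Basis.eq_of_apply_eq
  intro i
  funext k
  have := congrFun (congrFun h i) k
  rw [IntBasis.toRat_apply, IntBasis.toRat_apply] at this
  exact_mod_cast this

theorem IntBasis.coe_toRat_replaceAdd {n : ℕ} (v : IntBasis n) (i j : Fin n) (hij : i ≠ j) :
    ⇑(v.replaceAdd i j hij).toRat = Function.update v.toRat j (v.toRat i + v.toRat j) := by
  funext l k
  rw [IntBasis.toRat_apply, IntBasis.coe_replaceAdd]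
  rcases eq_or_ne l j with rfl | h
  · simp [IntBasis.toRat_apply]
  · simp [h, IntBasis.toRat_apply]

theorem IntBasis.coe_toRat_unitsSMul {n : ℕ} (v : IntBasis n) (ε : Fin n → ℤˣ) :
    ⇑(IntBasis.toRat (v.unitsSMul ε)) = fun i => (ε i : ℤ) • v.toRat i := by
  funext l k
  rw [IntBasis.toRat_apply, Module.Basis.unitsSMul_apply]
  simp [IntBasis.toRat_apply, Units.smul_def]

theorem IntBasis.coe_toRat_reindex {n : ℕ} (v : IntBasis n) (σ : Equiv.Perm (Fin n)) :
    ⇑(IntBasis.toRat (v.reindex σ.symm)) = v.toRat ∘ σ := by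
  funext l k
  rw [IntBasis.toRat_apply, Module.Basis.reindex_apply]
  simp [IntBasis.toRat_apply]

end StandardLattice

/-! ### Comparison of the two presentations -/

section Presentation

variable {n : ℕ} (hn : 2 ≤ n)

/-- The map from the presented group to symbols for the standard lattice. -/
def presentedToSymb : Presented hn →+ Symb (intVectors n) n :=
  QuotientAddGroup.lift _ (FreeAbelianGroup.lift (fun v => sym _ v.toRat)) (by
    rw [AddSubgroup.closure_le]
    rintro r (⟨v⟩ | ⟨v, ε⟩ | ⟨v, σ⟩)
    · have h := isSymb_sym.add v.toRat (⟨0, by omega⟩ : Fin n) ⟨1, by omega⟩ (by simp)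
        v.isPrimitive_toRat
      rw [SetLike.mem_coe, AddMonoidHom.mem_ker]
      simp only [map_sub, map_add, FreeAbelianGroup.lift_apply_of, IntBasis.coe_toRat_replaceAdd]
      rw [h, add_comm (v.toRat ⟨1, _⟩), sub_self]
    · rw [SetLike.mem_coe, AddMonoidHom.mem_ker]
      simp only [map_sub, FreeAbelianGroup.lift_apply_of, IntBasis.coe_toRat_unitsSMul]
      rw [(sym_smul_units _ v.isPrimitive_toRat ε).2, sub_self]
    · rw [SetLike.mem_coe, AddMonoidHom.mem_ker]
      simp only [map_sub, map_zsmul, FreeAbelianGroup.lift_apply_of, IntBasis.coe_toRat_reindex]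
      rw [isSymb_sym.perm _ _ v.isPrimitive_toRat, sub_self])

theorem presentedToSymb_symbol (v : IntBasis n) :
    presentedToSymb hn (symbol hn v) = sym _ v.toRat := by
  simp [presentedToSymb, symbol]

theorem symbol_reindex (v : IntBasis n) (σ : Equiv.Perm (Fin n)) :
    symbol hn (v.reindex σ.symm) = (Equiv.Perm.sign σ : ℤ) • symbol hn v := by
  rw [← sub_eq_zero]
  exact (QuotientAddGroup.eq_zero_iff _).mpr (AddSubgroup.subset_closure (.perm v σ))

theorem symbol_unitsSMul (v : IntBasis n) (ε : Fin n → ℤˣ) :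
    symbol hn (v.unitsSMul ε) = symbol hn v := by
  rw [← sub_eq_zero]
  exact (QuotientAddGroup.eq_zero_iff _).mpr (AddSubgroup.subset_closure (.sign v ε))

theorem symbol_replaceAdd_zero_one (v : IntBasis n) :
    symbol hn v = symbol hn (v.replaceAdd ⟨0, by omega⟩ ⟨1, by omega⟩ (by simp)) +
      symbol hn (v.replaceAdd ⟨1, by omega⟩ ⟨0, by omega⟩ (by simp)) := by
  rw [← sub_eq_zero]
  exact (QuotientAddGroup.eq_zero_iff _).mpr (AddSubgroup.subset_closure (.manin v))

theorem exists_perm_apply_eq {α : Type*} [DecidableEq α] {a b i j : α} (hab : a ≠ b)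
    (hij : i ≠ j) : ∃ σ : Equiv.Perm α, σ a = i ∧ σ b = j := by
  have h : a ≠ (Equiv.swap a i).symm j := by
    intro h
    have := congrArg (Equiv.swap a i) h
    rw [Equiv.apply_symm_apply, Equiv.swap_apply_left] at this
    exact hij this
  refine ⟨Equiv.swap a i * Equiv.swap b ((Equiv.swap a i).symm j), ?_, ?_⟩
  · rw [Equiv.Perm.mul_apply, Equiv.swap_apply_of_ne_of_ne hab h, Equiv.swap_apply_left]
  · rw [Equiv.Perm.mul_apply, Equiv.swap_apply_left, Equiv.apply_symm_apply]

theorem IntBasis.replaceAdd_reindex (v : IntBasis n) (σ : Equiv.Perm (Fin n)) (i j : Fin n)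
    (hij : i ≠ j) (hij' : σ i ≠ σ j) :
    IntBasis.replaceAdd (v.reindex σ.symm) i j hij =
      (v.replaceAdd (σ i) (σ j) hij').reindex σ.symm := by
  apply Module.Basis.eq_of_apply_eq
  intro l
  rw [Module.Basis.reindex_apply, IntBasis.coe_replaceAdd, IntBasis.coe_replaceAdd]
  rcases eq_or_ne l j with rfl | h
  · simp
  · have : σ l ≠ σ j := fun h' => h (σ.injective h')
    simp [h, this]

/-- Permuting the tuple carries positions 0, 1 to `i`, `j`, and all three terms acquire the same
sign. -/
theorem symbol_replaceAdd (v : IntBasis n) (i j : Fin n) (hij : i ≠ j) :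
    symbol hn v = symbol hn (v.replaceAdd i j hij) + symbol hn (v.replaceAdd j i hij.symm) := by
  have h01 : (⟨0, by omega⟩ : Fin n) ≠ ⟨1, by omega⟩ := by simp
  obtain ⟨σ, rfl, rfl⟩ := exists_perm_apply_eq h01 hij
  have h := symbol_replaceAdd_zero_one hn (v.reindex σ.symm)
  rw [IntBasis.replaceAdd_reindex v σ _ _ _ hij, IntBasis.replaceAdd_reindex v σ _ _ _ hij.symm,
    symbol_reindex, symbol_reindex, symbol_reindex, ← smul_add] at h
  have h' := congrArg (fun x => (Equiv.Perm.sign σ : ℤ) • x) h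
  simp only [smul_smul] at h'
  have hs : (Equiv.Perm.sign σ : ℤ) * (Equiv.Perm.sign σ : ℤ) = 1 := by
    rw [← Units.val_mul, Int.units_mul_self, Units.val_one]
  rwa [hs, one_smul, one_smul] at h'

open Classical in
/-- The symbol, in the presented group, of a tuple of rational vectors that comes from an integral
basis. -/
def tupleSymbol (b : Fin n → Fin n → ℚ) : Presented hn :=
  if h : ∃ v : IntBasis n, ⇑v.toRat = b then symbol hn h.choose else 0

theorem tupleSymbol_toRat (v : IntBasis n) : tupleSymbol hn v.toRat = symbol hn v := by
  have h : ∃ v' : IntBasis n, ⇑v'.toRat = ⇑v.toRat := ⟨v, rfl⟩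
  rw [tupleSymbol, dif_pos h, IntBasis.toRat_injective h.choose_spec]

/-- This supplies the inverse of `presentedToSymb`. The default value 0 fits the degenerate
relators, because a non-primitive tuple never comes from an integral basis. -/
theorem isSymb_tupleSymbol : IsSymb (intVectors n) (tupleSymbol hn) where
  degenerate b hb := by
    rw [tupleSymbol, dif_neg]
    rintro ⟨v, rfl⟩
    exact hb v.isPrimitive_toRat
  add b i j hij hb := by
    obtain ⟨v, rfl⟩ := hb.exists_intBasis
    have h := IntBasis.coe_toRat_replaceAdd v j i hij.symm
    rw [add_comm] at h
    rw [← IntBasis.coe_toRat_replaceAdd v i j hij, ← h]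
    simp only [tupleSymbol_toRat]
    exact symbol_replaceAdd hn v i j hij
  neg b i hb := by
    obtain ⟨v, rfl⟩ := hb.exists_intBasis
    have : Function.update v.toRat i (-v.toRat i) =
        ⇑(IntBasis.toRat (v.unitsSMul (Function.update 1 i (-1)))) := by
      rw [IntBasis.coe_toRat_unitsSMul]
      funext l
      rcases eq_or_ne l i with rfl | h
      · simp
      · simp [h]
    rw [this, tupleSymbol_toRat, tupleSymbol_toRat, symbol_unitsSMul]
  perm b σ hb := by
    obtain ⟨v, rfl⟩ := hb.exists_intBasis
    rw [← IntBasis.coe_toRat_reindex, tupleSymbol_toRat, tupleSymbol_toRat, symbol_reindex]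

theorem presented_hom_ext {A : Type*} [AddCommGroup A] {f g : Presented hn →+ A}
    (h : ∀ v, f (symbol hn v) = g (symbol hn v)) : f = g := by
  apply QuotientAddGroup.addMonoidHom_ext
  apply FreeAbelianGroup.lift_ext
  exact h

theorem presentedToSymb_injective : Function.Injective (presentedToSymb hn) := by
  have h : (Symb.lift _ (isSymb_tupleSymbol hn)).comp (presentedToSymb hn) =
      AddMonoidHom.id _ := by
    refine presented_hom_ext hn (fun v => ?_)
    rw [AddMonoidHom.comp_apply, presentedToSymb_symbol, Symb.lift_sym, tupleSymbol_toRat,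
      AddMonoidHom.id_apply]
  exact Function.LeftInverse.injective (DFunLike.congr_fun h)

theorem presentedToSymb_surjective : Function.Surjective (presentedToSymb hn) := by
  intro x
  induction x using Symb.induction with
  | zero => exact ⟨0, map_zero _⟩
  | add x y hx hy =>
    obtain ⟨p, rfl⟩ := hx
    obtain ⟨q, rfl⟩ := hy
    exact ⟨p + q, map_add _ _ _⟩
  | neg x hx =>
    obtain ⟨p, rfl⟩ := hx
    exact ⟨-p, map_neg _ _⟩
  | sym b hb =>
    obtain ⟨v, rfl⟩ := hb.exists_intBasis
    exact ⟨symbol hn v, presentedToSymb_symbol hn v⟩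

end Presentation

/-! ### Chains of the Tits building as chains of full flags -/

section Tits

theorem Flag.lt_finrank {n k : ℕ} (s : Flag (Tits n) k) (i : Fin k) :
    (i : ℕ) < Module.finrank ℚ (s.1 i).1 := by
  obtain ⟨i, hi⟩ := i
  induction i with
  | zero =>
    have := (s.1 ⟨0, hi⟩).2.1
    exact Nat.pos_of_ne_zero (fun h => this (Submodule.finrank_eq_zero.mp h))
  | succ i ih =>
    have h1 := ih (by omega)
    have h2 : (s.1 ⟨i, by omega⟩).1 < (s.1 ⟨i + 1, hi⟩).1 := s.2 (Fin.lt_def.mpr (by simp))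
    have h3 := Submodule.finrank_lt_finrank_of_lt h2
    simp only at h1 ⊢
    omega

theorem Flag.finrank_add_lt {n k : ℕ} (s : Flag (Tits n) k) (j : ℕ) (i : Fin k)
    (hj : (i : ℕ) + j + 1 = k) : Module.finrank ℚ (s.1 i).1 + j < n := by
  induction j generalizing i with
  | zero =>
    have := Submodule.finrank_lt (s.1 i).2.2
    simpa using this
  | succ j ih =>
    have h1 := ih ⟨i + 1, by omega⟩ (by simp only; omega)
    have h2 : (s.1 i).1 < (s.1 ⟨i + 1, by omega⟩).1 := s.2 (Fin.lt_def.mpr (by simp))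
    have h3 := Submodule.finrank_lt_finrank_of_lt h2
    omega

/-- Flags in the building have fewer than `n` members. -/
theorem isEmpty_flag_tits (m : ℕ) : IsEmpty (Flag (Tits (m + 1)) (m + 1)) := by
  refine ⟨fun s => ?_⟩
  have h1 := s.lt_finrank (Fin.last m)
  have h2 := s.finrank_add_lt 0 (Fin.last m) (by simp)
  simp only [Fin.val_last] at h1
  omega

/-- The flag is as long as possible: strict growth from below and from above leaves one dimension
for each position. -/
theorem Flag.finrank_eq {m : ℕ} (s : Flag (Tits (m + 2)) (m + 1)) (i : Fin (m + 1)) :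
    Module.finrank ℚ (s.1 i).1 = (i : ℕ) + 1 := by
  have h1 := s.lt_finrank i
  have h2 := s.finrank_add_lt (m - i) i (by omega)
  omega

/-- A maximal flag of the building, completed by the whole space. -/
def Flag.complete {m : ℕ} (s : Flag (Tits (m + 2)) (m + 1)) :
    Fin (m + 2) → Submodule ℚ (Fin (m + 2) → ℚ) :=
  flagSnoc ⊤ (fun i => (s.1 i).1)

theorem Flag.complete_injective (m : ℕ) :
    Function.Injective (Flag.complete : Flag (Tits (m + 2)) (m + 1) → _) := by
  intro s s' h
  have := congrArg flagInit h
  simp only [Flag.complete, flagInit_flagSnoc] at this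
  apply Subtype.ext
  funext i
  apply Subtype.ext
  exact congrFun this i

theorem Flag.isFullFlag_complete {m : ℕ} (s : Flag (Tits (m + 2)) (m + 1)) :
    IsFullFlag s.complete := by
  refine IsFullFlag.flagSnoc ⟨fun i j h => ?_, fun i => s.finrank_eq i⟩ le_top (by simp)
  exact s.2.monotone h

theorem boundary_eq_sum {A : Type*} [Preorder A] {k : ℕ} (c : Chains A (k + 1)) :
    boundary A k c = ∑ i : Fin (k + 1), (-1 : ℤ) ^ (i : ℕ) • c.mapDomain (fun s => s.face i) := by
  induction c using Finsupp.induction_linear with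
  | zero => simp
  | add c c' hc hc' =>
    simp only [map_add, hc, hc', Finsupp.mapDomain_add, smul_add, Finset.sum_add_distrib]
  | single s x =>
    have hs : Finsupp.single s x = x • Finsupp.single s (1 : ℤ) := by simp
    rw [hs, map_smul, boundary_single, Finset.smul_sum]
    refine Finset.sum_congr rfl (fun i _ => ?_)
    rw [Finsupp.mapDomain_smul, Finsupp.mapDomain_single, smul_comm]

/-- Faces omitting members of different dimensions do not cancel. -/
theorem mapDomain_face_eq_zero {m : ℕ} {c : Chains (Tits (m + 2)) (m + 1)}
    (hc : boundary (Tits (m + 2)) m c = 0) (j : Fin (m + 1)) :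
    c.mapDomain (fun s => s.face j) = 0 := by
  classical
  rw [boundary_eq_sum] at hc
  -- The dimensions in a face reveal which position was omitted, so filtering by them isolates the
  -- `j`-th summand of the boundary.
  let q : Flag (Tits (m + 2)) m → Prop := fun G =>
    ∀ l, Module.finrank ℚ (G.1 l).1 = (j.succAbove l : ℕ) + 1
  have hq : ∀ (i : Fin (m + 1)) (s : Flag (Tits (m + 2)) (m + 1)), q (s.face i) ↔ i = j := by
    intro i s
    constructor
    · intro h
      apply Fin.succAbove_left_injective
      funext l
      have h1 := h l
      have h2 := s.finrank_eq (i.succAbove l)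
      apply Fin.ext
      change Module.finrank ℚ (s.1 (i.succAbove l)).1 = _ at h1
      omega
    · rintro rfl l
      exact s.finrank_eq (i.succAbove l)
  have h := congrArg (Finsupp.filterAddHom q) hc
  rw [map_sum, map_zero, Finset.sum_eq_single j] at h
  · rw [map_zsmul] at h
    change (-1 : ℤ) ^ (j : ℕ) • (Finsupp.filter q _) = 0 at h
    rw [mapDomain_filter_comm _ (fun _ => True) q (fun s => by simp [hq])] at h
    have h' := congrArg (fun x => (-1 : ℤ) ^ (j : ℕ) • x) h
    simp only [smul_smul, ← mul_pow] at h'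
    have htrue : c.filter (fun _ => True) = c := by ext s; simp
    simpa [htrue] using h'
  · intro i _ hi
    rw [map_zsmul]
    change (-1 : ℤ) ^ (i : ℕ) • (Finsupp.filter q _) = 0
    rw [mapDomain_filter_comm _ (fun _ => False) q (fun s => by simp [hq, hi])]
    have hfalse : c.filter (fun _ => False) = 0 := by ext s; simp
    simp [hfalse]
  · simp

theorem isFlagCycle_mapDomain_complete {m : ℕ} {c : Chains (Tits (m + 2)) (m + 1)}
    (hc : boundary (Tits (m + 2)) m c = 0) : IsFlagCycle (c.mapDomain Flag.complete) where
  isFullFlag f hf := by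
    classical
    obtain ⟨s, -, rfl⟩ := Finset.mem_image.mp (Finsupp.mapDomain_support hf)
    exact s.isFullFlag_complete
  mapDomain_eq_zero j hj := by
    induction j using Fin.lastCases with
    | last => simp at hj
    | cast j =>
      have e : (fun f => Function.update f j.castSucc ⊥) ∘
          (Flag.complete : Flag (Tits (m + 2)) (m + 1) → _) =
          (fun G : Flag (Tits (m + 2)) m => flagSnoc ⊤
            (j.insertNth (α := fun _ => Submodule ℚ (Fin (m + 2) → ℚ)) ⊥ (fun i => (G.1 i).1))) ∘
            fun s => s.face j := by
        funext s
        simp only [Function.comp_apply, Flag.complete, flagSnoc, ← Fin.snoc_update]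
        congr 1
        funext i
        rcases Fin.eq_self_or_eq_succAbove j i with rfl | ⟨l, rfl⟩
        · simp
        · simp [Flag.face]
      rw [← Finsupp.mapDomain_comp, e, Finsupp.mapDomain_comp, mapDomain_face_eq_zero hc,
        Finsupp.mapDomain_zero]

theorem complete_basisFlag {m : ℕ} (hn : 2 ≤ m + 2) (w : RatBasis (m + 2)) :
    Flag.complete (m := m) (basisFlag hn w) = spanFlag w := by
  rw [spanFlag_succ, Flag.complete, show sp w = ⊤ from w.span_eq]
  congr 1
  funext i
  change Submodule.span ℚ (w '' {j | (j : ℕ) ≤ (i : ℕ)}) = _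
  have := congrArg flagInit (spanFlag_succ w)
  rw [flagInit_flagSnoc] at this
  rw [← this]
  rfl

theorem mapDomain_complete_apartmentChain {m : ℕ} (hn : 2 ≤ m + 2) (v : IntBasis (m + 2)) :
    Finsupp.mapDomain (Flag.complete (m := m)) (apartmentChain hn v.toRat) =
      apartmentSign (m + 2) • apartmentMap (intVectors (m + 2)) (m + 2) (sym _ v.toRat) := by
  rw [apartmentMap_sym_eq_sum _ v.isPrimitive_toRat, smul_smul, apartmentSign_mul_self, one_smul]
  change Finsupp.mapDomain.addMonoidHom (Flag.complete (m := m)) (∑ σ, _) = _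
  rw [map_sum]
  refine Finset.sum_congr rfl (fun σ _ => ?_)
  rw [map_zsmul, Finsupp.mapDomain.addMonoidHom_apply]
  congr 1
  refine Finsupp.mapDomain_single.trans ?_
  rw [complete_basisFlag]
  congr 2
  funext i
  simp

theorem chainsMap_titsMap_apartmentChain {n : ℕ} (hn : 2 ≤ n) (g : GL (Fin n) ℚ)
    (w w' : RatBasis n) (h : ∀ i, w' i = glEquiv g (w i)) :
    chainsMap (titsMap g) (titsMap_strictMono g) (n - 2 + 1) (apartmentChain hn w) =
      apartmentChain hn w' := by
  simp only [apartmentChain, map_sum, map_smul]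
  refine Finset.sum_congr rfl (fun σ _ => ?_)
  congr 1
  refine (Finsupp.mapDomain_single).trans ?_
  congr 1
  apply Subtype.ext
  funext i
  apply Subtype.ext
  change Submodule.map (glEquiv g).toLinearMap (Submodule.span ℚ _) = Submodule.span ℚ _
  rw [Submodule.map_span, Set.image_image]
  congr 1
  refine Set.image_congr (fun j _ => ?_)
  simp [h]

theorem steinbergRepInt_apartmentClass {n : ℕ} (hn : 2 ≤ n) (M : GL (Fin n) ℤ) (v : IntBasis n) :
    steinbergRepInt n M (apartmentClass hn v.toRat) = apartmentClass hn (v.act M).toRat := by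
  set g := Matrix.GeneralLinearGroup.map (n := Fin n) (Int.castRingHom ℚ) M with hg
  change Submodule.Quotient.mk (cyclesMap (titsMap g) (titsMap_strictMono g) (n - 2) _) =
    Submodule.Quotient.mk _
  congr 1
  apply Subtype.ext
  refine chainsMap_titsMap_apartmentChain hn g v.toRat (v.act M).toRat (fun i => ?_)
  funext k
  rw [IntBasis.toRat_apply, IntBasis.act_apply, glEquiv_apply]
  simp [Matrix.mulVec, dotProduct, hg, IntBasis.toRat_apply]

end Tits

/-! ### The presentation of the Steinberg module -/

section Steinberg

/-- The cycle of the apartment of an integral basis. -/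
def apartmentCycle {n : ℕ} (hn : 2 ≤ n) (v : IntBasis n) :
    LinearMap.ker (boundary (Tits n) (n - 2)) :=
  ⟨apartmentChain hn v.toRat, boundary_apartmentChain hn v.toRat⟩

/-- Completion of flags, on cycles. -/
def completeCycles (m : ℕ) : LinearMap.ker (boundary (Tits (m + 2)) m) →+
    FlagChains (Fin (m + 2) → ℚ) (m + 2) :=
  (Finsupp.mapDomain.addMonoidHom Flag.complete).comp
    (LinearMap.ker (boundary (Tits (m + 2)) m)).subtype.toAddMonoidHom

theorem completeCycles_injective (m : ℕ) : Function.Injective (completeCycles m) :=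
  (Finsupp.mapDomain_injective (Flag.complete_injective m)).comp Subtype.val_injective

theorem completeCycles_apartmentCycle {m : ℕ} (hn : 2 ≤ m + 2) (v : IntBasis (m + 2)) :
    completeCycles m (apartmentCycle hn v) = apartmentSign (m + 2) •
      apartmentMap (intVectors (m + 2)) (m + 2) (presentedToSymb hn (symbol hn v)) := by
  rw [presentedToSymb_symbol]
  exact mapDomain_complete_apartmentChain hn v

theorem completeCycles_lift {m : ℕ} (hn : 2 ≤ m + 2) (x : FreeAbelianGroup (IntBasis (m + 2))) :
    completeCycles m (FreeAbelianGroup.lift (apartmentCycle hn) x) = apartmentSign (m + 2) •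
      apartmentMap (intVectors (m + 2)) (m + 2)
        (presentedToSymb hn (QuotientAddGroup.mk x)) := by
  induction x using FreeAbelianGroup.induction_on with
  | zero => simp
  | of v =>
    rw [FreeAbelianGroup.lift_apply_of]
    exact completeCycles_apartmentCycle hn v
  | neg v h => rw [map_neg, map_neg, h, QuotientAddGroup.mk_neg, map_neg, map_neg, smul_neg]
  | add x y hx hy =>
    rw [map_add, map_add, hx, hy, QuotientAddGroup.mk_add, map_add, map_add, smul_add]

/-- The map from the presented group to cycles of the building. -/
def presentedToCycles {m : ℕ} (hn : 2 ≤ m + 2) :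
    Presented hn →+ LinearMap.ker (boundary (Tits (m + 2)) m) :=
  QuotientAddGroup.lift _ (FreeAbelianGroup.lift (apartmentCycle hn)) (by
    intro x hx
    rw [AddMonoidHom.mem_ker]
    -- Relators need no check in the building: after completion, the cycle depends only on the class
    -- in `Presented hn`, which is zero here.
    apply completeCycles_injective m
    rw [completeCycles_lift, (QuotientAddGroup.eq_zero_iff x).mpr hx, map_zero, map_zero, smul_zero,
      map_zero])

theorem completeCycles_presentedToCycles {m : ℕ} (hn : 2 ≤ m + 2) (p : Presented hn) :
    completeCycles m (presentedToCycles hn p) = apartmentSign (m + 2) •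
      apartmentMap (intVectors (m + 2)) (m + 2) (presentedToSymb hn p) := by
  obtain ⟨x, rfl⟩ := QuotientAddGroup.mk_surjective p
  exact completeCycles_lift hn x

theorem presentedToCycles_bijective {m : ℕ} (hn : 2 ≤ m + 2) :
    Function.Bijective (presentedToCycles hn) := by
  constructor
  · rw [injective_iff_map_eq_zero]
    intro p hp
    have h := completeCycles_presentedToCycles hn p
    rw [hp, map_zero] at h
    have h' := congrArg (fun x => apartmentSign (m + 2) • x) h
    simp only [smul_smul, apartmentSign_mul_self, one_smul, smul_zero] at h'
    apply presentedToSymb_injective hn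
    apply apartmentMap_injective (isLatticeIn_intVectors (m + 2))
    rw [← h', map_zero, map_zero]
  · intro c
    obtain ⟨x, hx⟩ := (isFlagCycle_mapDomain_complete c.2).exists_apartmentMap_eq
      (isLatticeIn_intVectors (m + 2))
    obtain ⟨p, rfl⟩ := presentedToSymb_surjective hn x
    -- The sign squares to 1, so it undoes itself.
    refine ⟨apartmentSign (m + 2) • p, ?_⟩
    apply completeCycles_injective m
    rw [completeCycles_presentedToCycles, map_zsmul, map_zsmul, smul_smul, apartmentSign_mul_self,
      one_smul, hx]
    rfl

/-- In top degree, homology classes are cycles. -/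
theorem steinberg_mk_bijective (m : ℕ) : Function.Bijective
    (Submodule.Quotient.mk : LinearMap.ker (boundary (Tits (m + 2)) m) →
      ReducedHomology (Tits (m + 2)) m) := by
  refine ⟨?_, Submodule.Quotient.mk_surjective _⟩
  intro c c' h
  rw [Submodule.Quotient.eq] at h
  obtain ⟨e, he⟩ := h
  -- There are only m + 1 dimensions for proper nonzero subspaces, hence no flags with m + 2 members
  -- and no boundaries.
  have : e = 0 := Finsupp.ext (fun s => ((isEmpty_flag_tits (m + 1)).false s).elim)
  rw [this, map_zero] at he
  rw [← sub_eq_zero]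
  exact Subtype.ext he.symm

end Steinberg

end TitsSteinberg

end

open TitsSteinberg in
theorem theoremB (n : ℕ) (hn : 2 ≤ n) :
    ∃ Φ : Presented hn ≃+ Steinberg n,
      (∀ v : IntBasis n, Φ (symbol hn v) = apartmentClass hn v.toRat) ∧
      (∀ (M : GL (Fin n) ℤ) (v : IntBasis n),
        steinbergRepInt n M (Φ (symbol hn v)) = Φ (symbol hn (v.act M))) := by
  -- With this form of `n`, the degree `n - 2` reduces definitionally to `m`.
  obtain ⟨m, rfl⟩ : ∃ m, n = m + 2 := ⟨n - 2, by omega⟩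
  let Ψ : Presented hn →+ Steinberg (m + 2) :=
    (Submodule.mkQ _).toAddMonoidHom.comp (presentedToCycles hn)
  have hΨ : Function.Bijective Ψ :=
    (steinberg_mk_bijective m).comp (presentedToCycles_bijective hn)
  have hsym : ∀ v : IntBasis (m + 2), Ψ (symbol hn v) = apartmentClass hn v.toRat := by
    intro v
    change Submodule.Quotient.mk (FreeAbelianGroup.lift (apartmentCycle hn) (gen v)) = _
    rw [FreeAbelianGroup.lift_apply_of]
    rfl
  refine ⟨AddEquiv.ofBijective Ψ hΨ, hsym, fun M v => ?_⟩
  rw [AddEquiv.ofBijective_apply, AddEquiv.ofBijective_apply, hsym, hsym,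
    steinbergRepInt_apartmentClass]
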